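/- Let $G\in\mathbb F_2[D]^{k_c\times n_c}$ be the generator matrix of a rate $R_c=k_c/n_c$ binary convolutional code with memory order $m$ (the largest degree of an entry of $G$), and let $d_f$ be its free distance, i.e. the least Hamming weight of $vG$ over nonzero $v\in\mathbb F_2[D]^{k_c}$; assume $d_f\ge 1$. Fix $H\ge 1$. A uniformly distributed message of $H$ blocks of $k_c$ bits, followed by $m$ zero blocks, is encoded into $n_c(H+m)$ antipodal symbols $x_{ij}=\pm1$, $1\le i\le n_c$, $1\le j\le H+m$, and received as $y_{ij}=\sqrt{E_c}\,\alpha_{ij}x_{ij}+n_{ij}$, where $E_b=\frac{H+m}{H}\frac1{R_c}E_c$ with $E_b,N_0>0$. The $n_{ij}$ are i.i.d. $\mathcal N(0,N_0/2)$, the fading envelopes $\alpha_{ij}$ (known to the decoder) are i.i.d. Rician with density $\frac{a}{\sigma^2}e^{-(a^2+s^2)/(2\sigma^2)}I_0(as/\sigma^2)$, $a\ge0$, where $s\ge 0$, $\sigma>0$, and are independent of the noise; $\gamma=s^2/(2\sigma^2)$ is the Rician factor. The decoder is the modified Yamamoto–Itoh Viterbi decoder with flag $u\ge 0$. Up to trellis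 level $m$ all paths survive with label $\mathcal C$. At each node of each level $t=m+1,\dots,H+m$, among the one-branch extensions of survivors that enter the node, let $x$ and $x'$ have the largest and second largest metric $\sum_{j\le t}\sum_i\alpha_{ij}x_{ij}y_{ij}$. Then $x$ survives; it has label $\mathcal C$ if it had label $\mathcal C$ at level $t-1$ and $$\sum_{j\le t}\sum_i\alpha_{ij}(x_{ij}-x'_{ij})y_{ij}\ \ge\ \frac{u}{d_f}\sqrt{\frac{N_0}{2}}\sum_{j\le t}\sum_i|x'_{ij}-x_{ij}|\,\alpha_{ij}^2,$$ and label $\mathcal X$ otherwise. The final survivor (at level $H+m$) is accepted if its label is $\mathcal C$; otherwise retransmission is requested. Let $\mathsf P_{\mathrm x}(u)$ be the probability that retransmission is requested, and let $\mathsf P_{\mathrm b}(u)$ be the average over the $Hk_c$ information bits of the probability that the final survivor is accepted and is wrong in that bit. ($u=0$ is Viterbi decoding without ARQ.) Then: (i) For fixed $\gamma\ge 0$ and $\sigma$, $\mathsf P_{\mathrm b}(0)=O\big((E_b/N_0)^{-d_f}\big)$ as $E_b/N_0\to\infty$. (ii) For fixed $\gamma\ge 0$ and $\sigma$ and every $\varepsilon>0$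 there is a flag $u_0>0$, a function of $E_b/N_0$, such that, as $E_b/N_0\to\infty$, $\mathsf P_{\mathrm x}(u_0)=O\big((E_b/N_0)^{-d_f}\big)$, and such that $\mathsf P_{\mathrm b}(u_0)\le(1+\varepsilon)\,4^{-d_f}\,\mathsf P_{\mathrm b}(0)$ for all sufficiently large $E_b/N_0$. (iii) Let $$\tilde h(u)=1-\frac1{\sigma^2}\left[\left(\sqrt{\frac{2E_c}{N_0}}+\frac u{d_f}\right)^2+\frac1{\sigma^2}\right]^{-1}.$$ For fixed $\sigma$, $E_b$, $N_0$ and $u\ge0$, $\liminf_{\gamma\to\infty}\frac{-\ln\mathsf P_{\mathrm b}(u)}{\gamma}\ge d_f\,\tilde h(u)$; if moreover $u<d_f\sqrt{2E_c/N_0}$, then $\liminf_{\gamma\to\infty}\frac{-\ln\mathsf P_{\mathrm x}(u)}{\gamma}\ge d_f\,\tilde h(-u)$ (with $-\ln 0=+\infty$). -/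

import Mathlib

open MeasureTheory ProbabilityTheory Filter Polynomial
open scoped ENNReal Topology

noncomputable section

namespace RicianViterbi

/-! ### Convolutional codes

A rate `k / n` binary convolutional encoder is given by its generator polynomial matrix `G`;
a block of `H` information blocks of `k` bits each is encoded and terminated by `m` zero blocks,
where `m` is the memory order. -/

section Code

variable {k n : ℕ}

/-- Memory order: the largest degree of an entry of the generator polynomial matrix. -/
def memory (G : Matrix (Fin k) (Fin n) (ZMod 2)[X]) : ℕ :=
  Finset.univ.sup fun a => Finset.univ.sup fun i => (G a i).natDegree

/-- Hamming weight of a tuple of binary polynomials (output sequences). -/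
def weight (c : Fin n → (ZMod 2)[X]) : ℕ := ∑ i, (c i).support.card

/-- Free distance: the least output weight of a trellis path that leaves the all-zero path and
returns to it, that is, of a nonzero finite input sequence. -/
def freeDist (G : Matrix (Fin k) (Fin n) (ZMod 2)[X]) : ℕ :=
  sInf {d | ∃ v : Fin k → (ZMod 2)[X], v ≠ 0 ∧ weight (Matrix.vecMul v G) = d}

/-- Messages: `H` blocks of `k` information bits. -/
abbrev Msg (k H : ℕ) : Type := Fin H → Fin k → ZMod 2

/-- The `j`-th input block of the encoder (from `j = 0`), followed by the zero tail. -/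
def block {H : ℕ} (w : Msg k H) (j : ℕ) : Fin k → ZMod 2 :=
  if h : j < H then w ⟨j, h⟩ else 0

/-- The polynomial input sequences that belong to a message. -/
def msgPoly {H : ℕ} (w : Msg k H) (a : Fin k) : (ZMod 2)[X] :=
  ∑ h : Fin H, monomial (h : ℕ) (w h a)

/-- Indices `(i, j)` of the `n (H + m)` encoder output symbols:
position `i` on the branch, time `j` (from `0`). -/
abbrev SymIdx (G : Matrix (Fin k) (Fin n) (ZMod 2)[X]) (H : ℕ) : Type :=
  Fin n × Fin (H + memory G)

/-- Antipodal modulation of the encoder output: bit `0` is sent as `1`, bit `1` as `-1`. -/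
def symbol (G : Matrix (Fin k) (Fin n) (ZMod 2)[X]) {H : ℕ} (w : Msg k H) (p : SymIdx G H) : ℝ :=
  if ((Matrix.vecMul (msgPoly w) G) p.1).coeff (p.2 : ℕ) = 0 then 1 else -1

/-- The trellis paths of `w` and `w'` coincide up to level `t`. -/
def SamePrefix {H : ℕ} (t : ℕ) (w w' : Msg k H) : Prop :=
  ∀ j < t, block w j = block w' j

/-- The trellis paths of `w` and `w'` are at the same node at level `t`:
the last `m` input blocks agree. -/
def SameNode (m : ℕ) {H : ℕ} (t : ℕ) (w w' : Msg k H) : Prop :=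
  ∀ j < t, t ≤ j + m → block w j = block w' j

end Code

/-! ### The modified Yamamoto-Itoh decoder

A trellis path of length `t` is represented by any message that has this prefix. All comparisons
below only involve the prefixes. Ties between metrics have probability zero. -/

section Decoder

variable {k n : ℕ} (G : Matrix (Fin k) (Fin n) (ZMod 2)[X]) {H : ℕ}

/-- Sum of the branch metrics of the path of `w` up to level `t`, for fading envelopes `α` and
received samples `y`. -/
def metric (α y : SymIdx G H → ℝ) (t : ℕ) (w : Msg k H) : ℝ :=
  ∑ p : SymIdx G H with (p.2 : ℕ) < t, α p * symbol G w p * y p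

/-- The path of `w` survives at level `t`. Up to level `m = K - 1` all paths survive; afterwards
the Viterbi recursion keeps at each node the best one-branch extension of a survivor. -/
def Survives (α y : SymIdx G H → ℝ) : ℕ → Msg k H → Prop
  | 0, _ => True
  | t + 1, w => t + 1 ≤ memory G ∨
      (Survives α y t w ∧ ∀ w', SameNode (memory G) (t + 1) w w' → Survives α y t w' →
        metric G α y (t + 1) w' ≤ metric G α y (t + 1) w)

/-- `w'` is a path, other than `w`, that extends a survivor of level `t` to the node of `w` at
level `t + 1`. -/
def Competitor (α y : SymIdx G H → ℝ) (t : ℕ) (w w' : Msg k H) : Prop :=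
  SameNode (memory G) (t + 1) w w' ∧ Survives G α y t w' ∧ ¬ SamePrefix (t + 1) w w'

/-- `w'` has the second largest metric at the node at level `t + 1` where `w` has the largest. -/
def RunnerUp (α y : SymIdx G H → ℝ) (t : ℕ) (w w' : Msg k H) : Prop :=
  Competitor G α y t w w' ∧
    ∀ w'', Competitor G α y t w w'' → metric G α y (t + 1) w'' ≤ metric G α y (t + 1) w'

/-- The acceptance test at level `t` of the path of `w` against that of `w'`, with flag `u` and
noise level `N₀`. -/
def Margin (N₀ u : ℝ) (α y : SymIdx G H → ℝ) (t : ℕ) (w w' : Msg k H) : Prop :=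
  u / (freeDist G : ℝ) * √(N₀ / 2) *
      ∑ p : SymIdx G H with (p.2 : ℕ) < t, |symbol G w' p - symbol G w p| * α p ^ 2
    ≤ ∑ p : SymIdx G H with (p.2 : ℕ) < t, α p * (symbol G w p - symbol G w' p) * y p

/-- The surviving path of `w` carries the label `C` at level `t` (otherwise it carries `X`).
All labels are `C` at level `m = K - 1`. -/
def LabelC (N₀ u : ℝ) (α y : SymIdx G H → ℝ) : ℕ → Msg k H → Prop
  | 0, _ => True
  | t + 1, w => t + 1 ≤ memory G ∨
      (LabelC N₀ u α y t w ∧ ∀ w', RunnerUp G α y t w w' → Margin G N₀ u α y (t + 1) w w')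

/-- `w` is decoded and accepted: it survives at the last level, with label `C`. -/
def Accepts (N₀ u : ℝ) (α y : SymIdx G H → ℝ) (w : Msg k H) : Prop :=
  Survives G α y (H + memory G) w ∧ LabelC G N₀ u α y (H + memory G) w

/-- Retransmission is requested: all survivors at the last level are labeled `X`. -/
def Retransmits (H : ℕ) (N₀ u : ℝ) (α y : SymIdx G H → ℝ) : Prop :=
  ∀ w : Msg k H, Survives G α y (H + memory G) w → ¬ LabelC G N₀ u α y (H + memory G) w

end Decoder

/-! ### The Rician fading channel with unlimited interleaving -/

section Channel

/-- Modified Bessel function of the first kind of order zero. -/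
def besselI0 (x : ℝ) : ℝ :=
  1 / (2 * Real.pi) * ∫ θ in (-Real.pi)..Real.pi, Real.exp (x * Real.cos θ)

/-- Rician density with noncentrality parameter `s` and scale parameter `σ`. -/
def ricianPDF (s σ a : ℝ) : ℝ :=
  if 0 ≤ a then
    a / σ ^ 2 * Real.exp (-((a ^ 2 + s ^ 2) / (2 * σ ^ 2))) * besselI0 (a * s / σ ^ 2)
  else 0

/-- The law of a fading envelope with Rician factor `γ = s² / (2 σ²)` and scale parameter `σ`. -/
def ricianLaw (γ σ : ℝ) : Measure ℝ :=
  volume.withDensity fun a => ENNReal.ofReal (ricianPDF (√(2 * γ) * σ) σ a)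

variable {k n : ℕ} (G : Matrix (Fin k) (Fin n) (ZMod 2)[X]) (H : ℕ)

/-- Joint law of all fading envelopes (i.i.d. Rician) and all noise samples (i.i.d. centred
Gaussian with variance `N₀ / 2`, independent of the fading). -/
def channelLaw (γ σ N₀ : ℝ) : Measure ((SymIdx G H → ℝ) × (SymIdx G H → ℝ)) :=
  (Measure.pi fun _ => ricianLaw γ σ).prod
    (Measure.pi fun _ => gaussianReal 0 (N₀ / 2).toNNReal)

/-- Energy per code symbol, from `E_b = ((H + m) / H) (1 / R_c) E_c` with `R_c = k / n`. -/
def codeEnergy (Eb : ℝ) : ℝ :=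
  Eb * ((H : ℝ) / ((H : ℝ) + (memory G : ℝ))) * ((k : ℝ) / (n : ℝ))

variable {H} in
/-- Received samples when `w` is sent: `y = √E_c α x + noise`. -/
def received (Eb : ℝ) (w : Msg k H) (α z : SymIdx G H → ℝ) (p : SymIdx G H) : ℝ :=
  √(codeEnergy G H Eb) * α p * symbol G w p + z p

/-- Average bit error probability with flag `u`: the probability, averaged over the information
bits and over equiprobable messages, that a message with a wrong bit is accepted. -/
def bitErrorProb (γ σ Eb N₀ u : ℝ) : ℝ≥0∞ :=
  (∑ w : Msg k H, ∑ h : Fin H, ∑ a : Fin k,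
      channelLaw G H γ σ N₀
        {ω | ∃ w' : Msg k H, Accepts G N₀ u ω.1 (received G Eb w ω.1 ω.2) w' ∧ w' h a ≠ w h a}) /
    ((Fintype.card (Msg k H) : ℝ≥0∞) * (H : ℝ≥0∞) * (k : ℝ≥0∞))

/-- Average retransmission probability with flag `u`, for equiprobable messages. -/
def retransProb (γ σ Eb N₀ u : ℝ) : ℝ≥0∞ :=
  (∑ w : Msg k H,
      channelLaw G H γ σ N₀ {ω | Retransmits G H N₀ u ω.1 (received G Eb w ω.1 ω.2)}) /
    (Fintype.card (Msg k H) : ℝ≥0∞)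

/-- The exponent function `h̃(u)`. -/
def hTilde (σ Eb N₀ u : ℝ) : ℝ :=
  1 - 1 / σ ^ 2 *
    ((√(2 * codeEnergy G H Eb / N₀) + u / (freeDist G : ℝ)) ^ 2 + 1 / σ ^ 2)⁻¹

end Channel

end RicianViterbi

end

open MeasureTheory ProbabilityTheory Filter Polynomial
open scoped ENNReal Topology

noncomputable section

namespace RicianViterbi

/-! ### Trellis paths -/

section Trellis

variable {k n H : ℕ}

/-! The decoder is reduced to comparisons between full-length code words. If a wrong path `w'` is
accepted while `w` was sent, then where the two last merge, `w'` passed the test against a runner-up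
at least as good as `w`; continuing that runner-up along `w'` gives a word `r`, possibly `w` itself,
that is at least as likely as `w` and against which `w'` passes the test (`Accepts.exists_margin`).
Conversely, a path passing the test against every word is accepted (`accepts_of_forall_margin`), so
a retransmission forces the sent path to fail some test.

Write `q` for `√(2 E_c / N₀)`. Each comparison is the sign of a form linear in the noise and
quadratic in the envelopes. A Chernoff bound integrates out the noise and leaves one factor `E
exp(-c α²)` per differing position, of which there are at least `d_f`. The Rician envelope is the
modulus of a planar Gaussian, so this transform is explicit (`lintegral_ricianLaw_exp`). With `c =
(q ± u/d_f)²/2`, bounding it by `1/(2σ²c)` gives the decay with `E_b/N₀`, and keeping only its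
exponential factor gives the exponents in `γ`.

For the gain `4^{-d_f}`, take `u = θ d_f q` with `θ < 1` close to `1`. Retransmissions keep the
order `q^{-2 d_f}`, with a factor `(1-θ)^{-2 d_f}`. A pairwise error under this flag is the
unflagged event with the envelopes stretched by `1+θ`. Errors come from small envelopes, where the
density is nearly linear, so stretching costs a factor close to `(1+θ)^{-2}` per position
(`exists_channelLaw_marginEvent_le`).

To pass from pairs to bits, let `d ≥ d_f` be the minimum distance of the terminated code. Up to
`O(q^{-2(d+1)})`, the bit error probability without flag is at least the sum of pairwise
probabilities over neighbours at distance `d` (`exists_sum_le_bitErrorEvent`), and the one with flag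
is at most its analogue (`exists_bitErrorEvent_le_sum`): two distinct rivals differ from `w` on at
least `d+1` positions together. Since a pairwise probability at distance `d` is at least of order
`q^{-2d}` (`exists_le_channelLaw_noiseEvent`), the remainders are absorbed into the factor `1+ε`. -/

theorem coeff_msgPoly (w : Msg k H) (a : Fin k) (j : ℕ) :
    (msgPoly w a).coeff j = block w j a := by
  simp only [msgPoly, finsetSum_coeff, coeff_monomial, block]
  split_ifs with h
  · rw [Finset.sum_eq_single (⟨j, h⟩ : Fin H)]
    · simp
    · intro b _ hb
      rw [if_neg]
      exact fun h' => hb (Fin.ext h')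
    · simp
  · refine Finset.sum_eq_zero fun b _ => if_neg ?_
    have := b.2
    omega

theorem natDegree_le_memory (G : Matrix (Fin k) (Fin n) (ZMod 2)[X]) (a : Fin k) (i : Fin n) :
    (G a i).natDegree ≤ memory G :=
  (Finset.le_sup (f := fun i => (G a i).natDegree) (Finset.mem_univ i)).trans
    (Finset.le_sup (f := fun a => Finset.univ.sup fun i => (G a i).natDegree) (Finset.mem_univ a))

theorem coeff_vecMul_msgPoly (G : Matrix (Fin k) (Fin n) (ZMod 2)[X]) (w : Msg k H) (i : Fin n)
    (j : ℕ) : (Matrix.vecMul (msgPoly w) G i).coeff j =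
      ∑ a, ∑ x ∈ Finset.HasAntidiagonal.antidiagonal j, block w x.1 a * (G a i).coeff x.2 := by
  simp only [Matrix.vecMul, dotProduct, finsetSum_coeff, coeff_mul, coeff_msgPoly]

variable (G : Matrix (Fin k) (Fin n) (ZMod 2)[X])

/-- A code symbol depends on the current and the last `m` input blocks only. -/
theorem symbol_congr {w w' : Msg k H} {p : SymIdx G H}
    (h : ∀ j ≤ (p.2 : ℕ), (p.2 : ℕ) ≤ j + memory G → block w j = block w' j) :
    symbol G w p = symbol G w' p := by
  unfold symbol
  rw [coeff_vecMul_msgPoly, coeff_vecMul_msgPoly]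
  congr 2
  refine Finset.sum_congr rfl fun a _ => Finset.sum_congr rfl fun x hx => ?_
  rw [Finset.HasAntidiagonal.mem_antidiagonal] at hx
  by_cases hm : x.2 ≤ memory G
  · rw [h x.1 (by omega) (by omega)]
  · rw [coeff_eq_zero_of_natDegree_lt
      (lt_of_le_of_lt (natDegree_le_memory G a p.1) (not_le.1 hm)), mul_zero, mul_zero]

theorem symbol_eq_or (w : Msg k H) (p : SymIdx G H) : symbol G w p = 1 ∨ symbol G w p = -1 := by
  unfold symbol
  split_ifs <;> simp

/-- The path that follows `v` up to level `t` and `w` from there on. -/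
def splice (t : ℕ) (v w : Msg k H) : Msg k H := fun h => if (h : ℕ) < t then v h else w h

theorem block_splice (t : ℕ) (v w : Msg k H) (j : ℕ) :
    block (splice t v w) j = if j < t then block v j else block w j := by
  unfold block splice
  split_ifs <;> rfl

theorem SameNode.refl (m t : ℕ) (w : Msg k H) : SameNode m t w w := fun _ _ _ => rfl

theorem SameNode.symm {m t : ℕ} {w w' : Msg k H} (h : SameNode m t w w') : SameNode m t w' w :=
  fun j hj hm => (h j hj hm).symm

theorem SameNode.trans {m t : ℕ} {w w' w'' : Msg k H} (h : SameNode m t w w')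
    (h' : SameNode m t w' w'') : SameNode m t w w'' :=
  fun j hj hm => (h j hj hm).trans (h' j hj hm)

variable {G}

theorem symbol_splice_of_lt {t : ℕ} (v w : Msg k H) {p : SymIdx G H} (hp : (p.2 : ℕ) < t) :
    symbol G (splice t v w) p = symbol G v p :=
  symbol_congr G fun j hj _ => by rw [block_splice, if_pos (by omega)]

theorem symbol_splice_of_ge {t : ℕ} {v w : Msg k H} (h : SameNode (memory G) t v w)
    {p : SymIdx G H} (hp : t ≤ (p.2 : ℕ)) :
    symbol G (splice t v w) p = symbol G w p := by
  refine symbol_congr G fun j hj hm => ?_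
  rw [block_splice]
  split_ifs with hjt
  · exact h j hjt (by omega)
  · rfl

theorem eq_of_block_eq {w w' : Msg k H} (h : ∀ j, block w j = block w' j) : w = w' := by
  funext j
  have := h j
  simpa [block] using this

theorem metric_congr {t : ℕ} {w w' : Msg k H} (h : SamePrefix t w w') (α y : SymIdx G H → ℝ) :
    metric G α y t w = metric G α y t w' := by
  refine Finset.sum_congr rfl fun p hp => ?_
  rw [symbol_congr G (fun j hj _ => h j (by simp at hp; omega))]

theorem Survives.congr {α y : SymIdx G H → ℝ} {t : ℕ} {w w' : Msg k H} (h : SamePrefix t w w')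
    (hs : Survives G α y t w) : Survives G α y t w' := by
  induction t generalizing w w' with
  | zero => trivial
  | succ t ih =>
    rcases hs with hs | ⟨hs, hmax⟩
    · exact Or.inl hs
    · refine Or.inr ⟨ih (fun j hj => h j (by omega)) hs, fun w'' hn hs'' => ?_⟩
      rw [← metric_congr h]
      exact hmax w'' (fun j hj hm => (h j hj).trans (hn j hj hm)) hs''

theorem metric_succ (α y : SymIdx G H → ℝ) (t : ℕ) (w : Msg k H) :
    metric G α y (t + 1) w = metric G α y t w +
      ∑ p : SymIdx G H with (p.2 : ℕ) = t, α p * symbol G w p * y p := by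
  unfold metric
  rw [← Finset.sum_union (Finset.disjoint_filter.2 fun p _ h h' => by omega)]
  congr 1
  ext p
  simp
  omega

/-- Principle of optimality: the branch leaving a node depends on the node only, so a better prefix
to the same node stays better after the common branch. -/
theorem metric_succ_splice (α y : SymIdx G H → ℝ) {t : ℕ} {v w : Msg k H}
    (h : SameNode (memory G) t v w) (hm : metric G α y t w ≤ metric G α y t v) :
    metric G α y (t + 1) w ≤ metric G α y (t + 1) (splice t v w) := by
  rw [metric_succ, metric_succ, metric_congr (w := splice t v w) (w' := v)
    (fun j hj => by rw [block_splice, if_pos hj])]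
  refine add_le_add hm (Finset.sum_le_sum fun p hp => ?_)
  rw [symbol_splice_of_ge h (by simp at hp; omega)]

/-- Every node is reached by a survivor whose metric is largest among all paths to the node. -/
theorem exists_survivor (α y : SymIdx G H → ℝ) (t : ℕ) (w : Msg k H) :
    ∃ v, SameNode (memory G) t v w ∧ Survives G α y t v ∧
      metric G α y t w ≤ metric G α y t v := by
  classical
  induction t generalizing w with
  | zero => exact ⟨w, SameNode.refl _ _ _, trivial, le_rfl⟩
  | succ t ih =>
    obtain ⟨v₀, hn₀, hs₀, hm₀⟩ := ih w
    have hpre : SamePrefix t v₀ (splice t v₀ w) := fun j hj => by rw [block_splice, if_pos hj]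
    have hnode : SameNode (memory G) (t + 1) (splice t v₀ w) w := by
      intro j hj hm
      rw [block_splice]
      split_ifs with h
      · exact hn₀ j h (by omega)
      · rfl
    let s : Finset (Msg k H) :=
      Finset.univ.filter fun v => SameNode (memory G) (t + 1) v w ∧ Survives G α y t v
    have hmem : splice t v₀ w ∈ s := by
      simp only [s, Finset.mem_filter_univ]
      exact ⟨hnode, hs₀.congr hpre⟩
    obtain ⟨v, hv, hmax⟩ := s.exists_max_image (metric G α y (t + 1)) ⟨_, hmem⟩
    simp only [s, Finset.mem_filter_univ] at hv hmax hmem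
    exact ⟨v, hv.1, Or.inr ⟨hv.2, fun w' hw' hs' => hmax w' ⟨hw'.symm.trans hv.1, hs'⟩⟩,
      (metric_succ_splice α y hn₀ hm₀).trans (hmax _ hmem)⟩

theorem LabelC.of_le {N₀ u : ℝ} {α y : SymIdx G H → ℝ} {t s : ℕ} {w : Msg k H} (hts : t ≤ s)
    (h : LabelC G N₀ u α y s w) : LabelC G N₀ u α y t w := by
  induction s, hts using Nat.le_induction with
  | base => exact h
  | succ s hs ih =>
    refine ih ?_
    rcases h with h | h
    · cases s with
      | zero => trivial
      | succ s => exact Or.inl (by omega)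
    · exact h.1

/-- Replacing the tail of the rival by the tail of the path itself does not change the test. -/
theorem margin_splice (N₀ u : ℝ) (α y : SymIdx G H → ℝ) {t : ℕ} {w r : Msg k H}
    (h : SameNode (memory G) t r w) :
    Margin G N₀ u α y (H + memory G) w (splice t r w) ↔ Margin G N₀ u α y t w r := by
  have key : ∀ f : ℝ → ℝ → SymIdx G H → ℝ, (∀ x p, f x x p = 0) →
      ∑ p : SymIdx G H with (p.2 : ℕ) < H + memory G,
        f (symbol G w p) (symbol G (splice t r w) p) p =
      ∑ p : SymIdx G H with (p.2 : ℕ) < t, f (symbol G w p) (symbol G r p) p := by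
    intro f hf
    rw [Finset.sum_filter, Finset.sum_filter]
    refine Finset.sum_congr rfl fun p _ => ?_
    rw [if_pos p.2.2]
    split_ifs with hp
    · rw [symbol_splice_of_lt _ _ hp]
    · rw [symbol_splice_of_ge h (not_lt.1 hp), hf]
  unfold Margin
  rw [key (fun a b p => |b - a| * α p ^ 2) (by simp),
    key (fun a b p => α p * (a - b) * y p) (by simp)]

theorem margin_le_metric {N₀ u : ℝ} (hu : 0 ≤ u) {α y : SymIdx G H → ℝ} {t : ℕ} {w r : Msg k H}
    (h : Margin G N₀ u α y t w r) : metric G α y t r ≤ metric G α y t w := by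
  unfold Margin at h
  have h0 : 0 ≤ u / (freeDist G : ℝ) * √(N₀ / 2) *
      ∑ p : SymIdx G H with (p.2 : ℕ) < t, |symbol G r p - symbol G w p| * α p ^ 2 := by
    have : 0 ≤ ∑ p : SymIdx G H with (p.2 : ℕ) < t, |symbol G r p - symbol G w p| * α p ^ 2 :=
      Finset.sum_nonneg fun p _ => by positivity
    positivity
  have h1 : metric G α y t w - metric G α y t r =
      ∑ p : SymIdx G H with (p.2 : ℕ) < t, α p * (symbol G w p - symbol G r p) * y p := by
    rw [metric, metric, ← Finset.sum_sub_distrib]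
    exact Finset.sum_congr rfl fun p _ => by ring
  linarith

/-- A path that passes the acceptance test against every other path is accepted. -/
theorem accepts_of_forall_margin {N₀ u : ℝ} (hu : 0 ≤ u) {α y : SymIdx G H → ℝ} {w : Msg k H}
    (h : ∀ v, Margin G N₀ u α y (H + memory G) w v) : Accepts G N₀ u α y w := by
  have hm : ∀ t w', SameNode (memory G) t w w' → Margin G N₀ u α y t w w' := fun t w' hn =>
    (margin_splice N₀ u α y hn.symm).1 (h _)
  have hs : ∀ t, Survives G α y t w := by
    intro t
    induction t with
    | zero => trivial
    | succ t ih => exact Or.inr ⟨ih, fun w' hn _ => margin_le_metric hu (hm _ _ hn)⟩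
  have hl : ∀ t, LabelC G N₀ u α y t w := by
    intro t
    induction t with
    | zero => trivial
    | succ t ih => exact Or.inr ⟨ih, fun w' hr => hm _ _ hr.1.1⟩
  exact ⟨hs _, hl _⟩

/-- An accepted path other than `w` passes the test against a path that is at least as likely
as `w`. -/
theorem Accepts.exists_margin {N₀ u : ℝ} {α y : SymIdx G H → ℝ} {w w' : Msg k H}
    (h : Accepts G N₀ u α y w') (hne : w' ≠ w) :
    ∃ r, r ≠ w' ∧ Margin G N₀ u α y (H + memory G) w' r ∧
      metric G α y (H + memory G) w ≤ metric G α y (H + memory G) r := by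
  classical
  obtain ⟨j, hj, hjmax⟩ : ∃ j : Fin H, w' j ≠ w j ∧ ∀ i : Fin H, w' i ≠ w i → i ≤ j := by
    have hnon : (Finset.univ.filter fun i : Fin H => w' i ≠ w i).Nonempty := by
      obtain ⟨i, hi⟩ := Function.ne_iff.1 hne
      exact ⟨i, by simpa using hi⟩
    obtain ⟨j, hj, hjmax⟩ := Finset.exists_max_image _ id hnon
    exact ⟨j, by simpa using hj, fun i hi => hjmax i (by simpa using hi)⟩
  have hbj : block w' j ≠ block w j := by simpa [block] using hj
  have hbi : ∀ i : ℕ, (j : ℕ) < i → block w' i = block w i := by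
    intro i hi
    unfold block
    split_ifs with hiH
    · by_contra hcon
      have := hjmax ⟨i, hiH⟩ hcon
      rw [Fin.le_def] at this
      simp only at this
      omega
    · rfl
  set m := memory G with hmdef
  -- Beyond block `j` the messages agree, so `t + 1` is the level at which their paths merge for
  -- good. It exceeds `m`, hence the label there records an actual test.
  set t := (j : ℕ) + m with ht
  obtain ⟨v, hvn, hvs, hvm⟩ := exists_survivor α y t w
  -- The spliced path still has block `j` of `w`: either `j` lies in the window that fixes the node
  -- at level `t`, or `m = 0` and `j = t` is beyond the splice.
  have hcomp : Competitor G α y t w' (splice t v w) := by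
    refine ⟨fun i hi hm => ?_, hvs.congr fun i hi => by rw [block_splice, if_pos hi], fun hsame => ?_⟩
    · rw [hbi i (by omega), block_splice]
      split_ifs with hit
      · exact (hvn i hit (by omega)).symm
      · rfl
    · have := hsame j (by omega)
      rw [block_splice] at this
      refine hbj (this.trans ?_)
      split_ifs with hit
      · exact hvn j hit (by omega)
      · rfl
  obtain ⟨r, hr, hrmax⟩ := Finset.exists_max_image
    (Finset.univ.filter fun r => Competitor G α y t w' r) (metric G α y (t + 1))
    ⟨_, by simpa using hcomp⟩
  simp only [Finset.mem_filter_univ] at hr hrmax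
  have hlab : LabelC G N₀ u α y (t + 1) w' := LabelC.of_le (by omega) h.2
  have hmar : Margin G N₀ u α y (t + 1) w' r := by
    rcases hlab with hlab | hlab
    · omega
    · exact hlab.2 r ⟨hr, hrmax⟩
  have hrn : SameNode (memory G) (t + 1) r w' := hr.1.symm
  -- The continuation along `w'` leaves the test unchanged, and the metric comparison with `w`
  -- survives because `w` and `w'` emit the same symbols from time `t + 1` on.
  refine ⟨splice (t + 1) r w', fun heq => hr.2.2 fun i hi => ?_,
    (margin_splice N₀ u α y hrn).2 hmar, ?_⟩
  · rw [← heq, block_splice, if_pos hi]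
  · have hmet := (metric_succ_splice α y hvn hvm).trans (hrmax _ hcomp)
    unfold metric at hmet ⊢
    rw [Finset.sum_filter] at hmet ⊢
    rw [Finset.sum_filter] at hmet ⊢
    have hsplit : ∀ f : SymIdx G H → ℝ, ∑ p, (if (p.2 : ℕ) < H + m then f p else 0) =
        ∑ p, (if (p.2 : ℕ) < t + 1 then f p else 0) +
        ∑ p, (if (p.2 : ℕ) < t + 1 then 0 else f p) := by
      intro f
      rw [← Finset.sum_add_distrib]
      refine Finset.sum_congr rfl fun p _ => ?_
      rw [if_pos p.2.2]
      split_ifs <;> simp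
    rw [hsplit, hsplit]
    refine add_le_add (hmet.trans (le_of_eq ?_)) (le_of_eq ?_)
    · refine Finset.sum_congr rfl fun p _ => ?_
      split_ifs with hp
      · rw [symbol_splice_of_lt _ _ hp]
      · rfl
    · refine Finset.sum_congr rfl fun p _ => ?_
      split_ifs with hp
      · rfl
      · rw [symbol_splice_of_ge hrn (not_lt.1 hp),
          symbol_congr G (w := w) (w' := w') fun i _ _ => (hbi i (by omega)).symm]

end Trellis

/-! ### Distances -/

section Distance

variable {k n H : ℕ} (G : Matrix (Fin k) (Fin n) (ZMod 2)[X])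

/-- The positions in which the code words of two messages differ. -/
def diffSet (w w' : Msg k H) : Finset (SymIdx G H) :=
  Finset.univ.filter fun p => symbol G w p ≠ symbol G w' p

variable {G}

theorem mem_diffSet {w w' : Msg k H} {p : SymIdx G H} :
    p ∈ diffSet G w w' ↔ symbol G w p ≠ symbol G w' p := by
  simp [diffSet]

theorem diffSet_comm (w w' : Msg k H) : diffSet G w w' = diffSet G w' w := by
  ext p
  simp only [mem_diffSet, ne_comm]

theorem block_sub (w w' : Msg k H) (j : ℕ) : block (w - w') j = block w j - block w' j := by
  unfold block
  split_ifs <;> simp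

/-- By linearity the difference of two code words is the output for the nonzero input `w - w'`. The
zero tail keeps all of its weight inside the first `H + m` branches. -/
theorem freeDist_le_card_diffSet {w w' : Msg k H} (h : w ≠ w') :
    freeDist G ≤ (diffSet G w w').card := by
  have hv : msgPoly (w - w') ≠ 0 := by
    intro h0
    refine h (sub_eq_zero.1 (eq_of_block_eq fun j => ?_))
    funext a
    rw [← coeff_msgPoly, h0]
    simp [block]
  have hle : freeDist G ≤ weight (Matrix.vecMul (msgPoly (w - w')) G) := Nat.sInf_le ⟨_, hv, rfl⟩
  refine hle.trans ?_
  unfold weight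
  rw [← Finset.card_sigma]
  refine Finset.card_le_card_of_surjOn (fun p : SymIdx G H => (⟨p.1, (p.2 : ℕ)⟩ : (_ : Fin n) × ℕ)) ?_
  rintro ⟨i, j⟩ hx
  rw [Finset.mem_coe, Finset.mem_sigma, mem_support_iff] at hx
  have hne := hx.2
  have hj : j < H + memory G := by
    by_contra hlt
    refine hne ?_
    rw [coeff_vecMul_msgPoly]
    refine Finset.sum_eq_zero fun a _ => Finset.sum_eq_zero fun x hx => ?_
    have hx : x.1 + x.2 = j := Finset.HasAntidiagonal.mem_antidiagonal.1 hx
    by_cases hx1 : x.1 < H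
    · rw [coeff_eq_zero_of_natDegree_lt
        (lt_of_le_of_lt (natDegree_le_memory G a i) (by omega)), mul_zero]
    · simp [block, hx1]
  refine ⟨(i, ⟨j, hj⟩), ?_, rfl⟩
  rw [Finset.mem_coe, mem_diffSet]
  have hsub : (Matrix.vecMul (msgPoly (w - w')) G i).coeff j =
      (Matrix.vecMul (msgPoly w) G i).coeff j - (Matrix.vecMul (msgPoly w') G i).coeff j := by
    simp only [coeff_vecMul_msgPoly, ← Finset.sum_sub_distrib, block_sub, Pi.sub_apply, sub_mul]
  have hbits : (Matrix.vecMul (msgPoly w) G i).coeff j ≠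
      (Matrix.vecMul (msgPoly w') G i).coeff j := by
    intro h0
    exact hne (by rw [hsub, h0, sub_self])
  have h2 : ∀ a b : ZMod 2, a ≠ b → (if a = 0 then (1 : ℝ) else -1) ≠ if b = 0 then 1 else -1 := by
    intro a b hab
    have h01 : ∀ c : ZMod 2, c = 0 ∨ c = 1 := by decide
    rcases h01 a with rfl | rfl <;> rcases h01 b with rfl | rfl
    · exact absurd rfl hab
    · rw [if_pos rfl, if_neg one_ne_zero]; norm_num
    · rw [if_pos rfl, if_neg one_ne_zero]; norm_num
    · exact absurd rfl hab
  exact h2 _ _ hbits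

/-- With binary symbols the set of differences from `w` determines the code word, and positive free
distance makes encoding injective. -/
theorem diffSet_injective (hG : 0 < freeDist G) {w v v' : Msg k H} (h : v ≠ v') :
    diffSet G w v ≠ diffSet G w v' := by
  intro heq
  have h1 := hG.trans_le (freeDist_le_card_diffSet h)
  obtain ⟨p, hp⟩ := Finset.card_pos.1 h1
  have h2 := Finset.ext_iff.1 heq p
  rw [mem_diffSet] at hp h2
  rw [mem_diffSet] at h2
  rcases symbol_eq_or G w p with h3 | h3 <;> rcases symbol_eq_or G v p with h4 | h4 <;>
    rcases symbol_eq_or G v' p with h5 | h5 <;>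
    rw [h3, h4, h5] at h2 <;> rw [h4, h5] at hp <;> grind

/-- Two distinct sets of size at least `d` cannot have a union of size `d`. The extra position makes
events with two rivals negligible. -/
theorem card_union_diffSet (hG : 0 < freeDist G) {w v v' : Msg k H} {d : ℕ} (h : v ≠ v')
    (hv : d ≤ (diffSet G w v).card) (hv' : d ≤ (diffSet G w v').card) :
    d + 1 ≤ (diffSet G w v ∪ diffSet G w v').card := by
  by_contra hlt
  have h1 := Finset.eq_of_subset_of_card_le
    (Finset.subset_union_left (s₁ := diffSet G w v) (s₂ := diffSet G w v')) (by omega)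
  have h2 := Finset.eq_of_subset_of_card_le
    (Finset.subset_union_right (s₁ := diffSet G w v) (s₂ := diffSet G w v')) (by omega)
  exact diffSet_injective hG h (h1.trans h2.symm)

theorem pos_of_freeDist_pos (hG : 0 < freeDist G) : 0 < k ∧ 0 < n := by
  have hne : {d | ∃ v : Fin k → (ZMod 2)[X], v ≠ 0 ∧ weight (Matrix.vecMul v G) = d}.Nonempty := by
    by_contra h
    rw [Set.not_nonempty_iff_eq_empty] at h
    -- The infimum of the empty set is `0`, so positivity of the free distance also yields a nonzero
    -- input.
    rw [freeDist, h, Nat.sInf_empty] at hG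
    exact lt_irrefl _ hG
  obtain ⟨d, v, hv, hd⟩ := hne
  constructor
  · rcases Nat.eq_zero_or_pos k with rfl | h
    · exact absurd (Subsingleton.elim v 0) hv
    · exact h
  · rcases Nat.eq_zero_or_pos n with rfl | h
    · have h0 : freeDist G ≤ 0 := Nat.sInf_le ⟨v, hv, by simp [weight]⟩
      omega
    · exact h

end Distance

/-! ### The Rician law -/

section Rician

theorem continuous_besselI0 : Continuous besselI0 := by
  unfold besselI0
  refine continuous_const.mul ?_
  refine intervalIntegral.continuous_parametric_intervalIntegral_of_continuous' ?_ _ _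
  fun_prop

theorem besselI0_nonneg (x : ℝ) : 0 ≤ besselI0 x := by
  unfold besselI0
  refine mul_nonneg (by positivity) (intervalIntegral.integral_nonneg ?_ fun θ _ => by positivity)
  linarith [Real.pi_pos]

theorem besselI0_zero : besselI0 0 = 1 := by
  unfold besselI0
  simp
  field_simp
  norm_num

theorem measurable_ricianPDF (s σ : ℝ) : Measurable (ricianPDF s σ) := by
  unfold ricianPDF
  refine Measurable.ite measurableSet_Ici ?_ measurable_const
  have := continuous_besselI0
  exact Continuous.measurable (by fun_prop)

theorem ricianPDF_nonneg (s σ a : ℝ) : 0 ≤ ricianPDF s σ a := by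
  unfold ricianPDF
  split_ifs
  · have := besselI0_nonneg (a * s / σ ^ 2)
    positivity
  · rfl

theorem lintegral_exp_neg_quadratic {b : ℝ} (hb : 0 < b) (x₀ r : ℝ) :
    ∫⁻ x : ℝ, ENNReal.ofReal (Real.exp (-b * (x - x₀) ^ 2 + r)) =
      ENNReal.ofReal (√(Real.pi / b) * Real.exp r) := by
  have h := (integrable_exp_neg_mul_sq hb).comp_sub_right x₀
  simp_rw [Real.exp_add]
  rw [← ofReal_integral_eq_lintegral_ofReal (h.mul_const _) (ae_of_all _ fun x => by positivity),
    integral_mul_const, integral_sub_right_eq_self (fun x : ℝ => Real.exp (-b * x ^ 2)) x₀,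
    integral_gaussian]

/-- The Laplace transform at `c` of the square of a Rician variable. -/
def ricianLaplace (γ σ c : ℝ) : ℝ :=
  (1 + 2 * σ ^ 2 * c)⁻¹ * Real.exp (-(γ * (2 * σ ^ 2 * c / (1 + 2 * σ ^ 2 * c))))

/-- The angular integral in `I₀` is undone: the integrand is the polar Jacobian `a` times a planar
Gaussian density with mean `(s, 0)`, weighted by `exp (-c |·|²)`. -/
theorem ofReal_ricianPDF_mul (s σ c a : ℝ) (ha : 0 < a) :
    ENNReal.ofReal (ricianPDF s σ a) * ENNReal.ofReal (Real.exp (-c * a ^ 2)) =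
      ∫⁻ θ in Set.Ioo (-Real.pi) Real.pi, ENNReal.ofReal a * ENNReal.ofReal
        ((2 * Real.pi * σ ^ 2)⁻¹ *
          (Real.exp (-((a * Real.cos θ - s) ^ 2 / (2 * σ ^ 2)) - c * (a * Real.cos θ) ^ 2) *
          Real.exp (-((a * Real.sin θ) ^ 2 / (2 * σ ^ 2)) - c * (a * Real.sin θ) ^ 2))) := by
  have hint : IntegrableOn (fun θ => a * ((2 * Real.pi * σ ^ 2)⁻¹ *
          (Real.exp (-((a * Real.cos θ - s) ^ 2 / (2 * σ ^ 2)) - c * (a * Real.cos θ) ^ 2) *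
          Real.exp (-((a * Real.sin θ) ^ 2 / (2 * σ ^ 2)) - c * (a * Real.sin θ) ^ 2))))
          (Set.Ioo (-Real.pi) Real.pi) := by
    refine (Continuous.integrableOn_Icc ?_).mono_set Set.Ioo_subset_Icc_self
    fun_prop
  simp_rw [← ENNReal.ofReal_mul ha.le]
  rw [← ENNReal.ofReal_mul (ricianPDF_nonneg _ _ _),
    ← ofReal_integral_eq_lintegral_ofReal hint (ae_of_all _ fun x => by positivity)]
  congr 1
  rw [← integral_Ioc_eq_integral_Ioo, ← intervalIntegral.integral_of_le (by linarith [Real.pi_pos])]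
  simp only [ricianPDF, if_pos ha.le, besselI0]
  rw [intervalIntegral.integral_const_mul, intervalIntegral.integral_const_mul]
  have hθ : ∀ θ : ℝ, Real.exp (-((a * Real.cos θ - s) ^ 2 / (2 * σ ^ 2)) - c * (a * Real.cos θ) ^ 2) *
          Real.exp (-((a * Real.sin θ) ^ 2 / (2 * σ ^ 2)) - c * (a * Real.sin θ) ^ 2) =
      Real.exp (-((a ^ 2 + s ^ 2) / (2 * σ ^ 2))) * Real.exp (-c * a ^ 2) *
        Real.exp (a * s / σ ^ 2 * Real.cos θ) := by
    intro θ
    rw [← Real.exp_add, ← Real.exp_add, ← Real.exp_add]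
    congr 1
    have := Real.sin_sq_add_cos_sq θ
    rcases eq_or_ne σ 0 with rfl | hσ
    · simp
      linear_combination (-c * a ^ 2) * this
    · field_simp
      linear_combination (-a ^ 2 - 2 * σ ^ 2 * c * a ^ 2) * this
  simp_rw [hθ]
  rw [intervalIntegral.integral_const_mul]
  simp only [mul_inv, div_eq_mul_inv]
  ring

/-- In Cartesian coordinates the integral factors into two one-dimensional Gaussian integrals.
Completing the square in the coordinate with mean `s` produces the exponential factor in `γ`. -/
theorem lintegral_ricianLaw_exp {γ σ c : ℝ} (hγ : 0 ≤ γ) (hσ : 0 < σ) (hc : 0 ≤ c) :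
    ∫⁻ a, ENNReal.ofReal (Real.exp (-c * a ^ 2)) ∂ricianLaw γ σ =
      ENNReal.ofReal (ricianLaplace γ σ c) := by
  set s := √(2 * γ) * σ with hs
  have hs2 : s ^ 2 = 2 * γ * σ ^ 2 := by
    rw [hs, mul_pow, Real.sq_sqrt (by positivity)]
  have hA : 0 < 1 / (2 * σ ^ 2) + c := by positivity
  rw [ricianLaw, lintegral_withDensity_eq_lintegral_mul _
    (measurable_ricianPDF _ _).ennreal_ofReal (by fun_prop)]
  simp only [Pi.mul_apply]
  have h0 : ∀ a ∉ Set.Ioi (0 : ℝ), ENNReal.ofReal (ricianPDF s σ a) *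
      ENNReal.ofReal (Real.exp (-c * a ^ 2)) = 0 := by
    intro a ha
    have : a ≤ 0 := by simpa using ha
    have : ricianPDF s σ a = 0 := by
      unfold ricianPDF
      split_ifs with h
      · have : a = 0 := le_antisymm this h
        simp [this]
      · rfl
    simp [this]
  rw [← setLIntegral_eq_of_support_subset (s := Set.Ioi (0 : ℝ))
    (fun a ha => by by_contra h; exact ha (h0 a h))]
  rw [setLIntegral_congr_fun measurableSet_Ioi (fun a ha => ofReal_ricianPDF_mul s σ c a ha)]
  rw [← lintegral_prod (μ := volume.restrict (Set.Ioi (0 : ℝ)))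
    (ν := volume.restrict (Set.Ioo (-Real.pi) Real.pi)) (fun p : ℝ × ℝ => ENNReal.ofReal p.1 * ENNReal.ofReal
        ((2 * Real.pi * σ ^ 2)⁻¹ *
          (Real.exp (-((p.1 * Real.cos p.2 - s) ^ 2 / (2 * σ ^ 2)) - c * (p.1 * Real.cos p.2) ^ 2) *
          Real.exp (-((p.1 * Real.sin p.2) ^ 2 / (2 * σ ^ 2)) - c * (p.1 * Real.sin p.2) ^ 2))))
    (Measurable.aemeasurable (by fun_prop)), Measure.prod_restrict, ← Measure.volume_eq_prod]
  have hpol := lintegral_comp_polarCoord_symm (fun p : ℝ × ℝ => ENNReal.ofReal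
        ((2 * Real.pi * σ ^ 2)⁻¹ *
          (Real.exp (-((p.1 - s) ^ 2 / (2 * σ ^ 2)) - c * p.1 ^ 2) *
          Real.exp (-(p.2 ^ 2 / (2 * σ ^ 2)) - c * p.2 ^ 2))))
  simp only [polarCoord_symm_apply, smul_eq_mul] at hpol
  refine Eq.trans hpol ?_
  have hpi : (0 : ℝ) ≤ (2 * Real.pi * σ ^ 2)⁻¹ := by positivity
  simp_rw [ENNReal.ofReal_mul hpi, ENNReal.ofReal_mul (Real.exp_nonneg _)]
  rw [lintegral_const_mul _ (by fun_prop), Measure.volume_eq_prod,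
    lintegral_prod_mul (f := fun x : ℝ => ENNReal.ofReal
      (Real.exp (-((x - s) ^ 2 / (2 * σ ^ 2)) - c * x ^ 2)))
      (g := fun y : ℝ => ENNReal.ofReal (Real.exp (-(y ^ 2 / (2 * σ ^ 2)) - c * y ^ 2)))
      (Measurable.aemeasurable (by fun_prop)) (Measurable.aemeasurable (by fun_prop))]
  have e1 : ∀ x : ℝ, -((x - s) ^ 2 / (2 * σ ^ 2)) - c * x ^ 2 =
      -(1 / (2 * σ ^ 2) + c) * (x - s / (1 + 2 * σ ^ 2 * c)) ^ 2 +
        -(γ * (2 * σ ^ 2 * c / (1 + 2 * σ ^ 2 * c))) := by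
    intro x
    have : (1 + 2 * σ ^ 2 * c) ≠ 0 := by positivity
    have hγ' : γ = s ^ 2 / (2 * σ ^ 2) := by rw [hs2]; field_simp
    rw [hγ']
    field_simp
    ring
  have e2 : ∀ y : ℝ, -(y ^ 2 / (2 * σ ^ 2)) - c * y ^ 2 =
      -(1 / (2 * σ ^ 2) + c) * (y - 0) ^ 2 + 0 := by
    intro y
    ring
  simp_rw [e1, e2]
  rw [lintegral_exp_neg_quadratic hA, lintegral_exp_neg_quadratic hA,
    ← ENNReal.ofReal_mul (by positivity), ← ENNReal.ofReal_mul (by positivity)]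
  congr 1
  rw [Real.exp_zero, ricianLaplace]
  have h1 := Real.mul_self_sqrt (show 0 ≤ Real.pi / (1 / (2 * σ ^ 2) + c) by positivity)
  have h2 : (2 * Real.pi * σ ^ 2)⁻¹ * (Real.pi / (1 / (2 * σ ^ 2) + c)) = (1 + 2 * σ ^ 2 * c)⁻¹ := by
    have : (1 + 2 * σ ^ 2 * c) ≠ 0 := by positivity
    have : (1 / (2 * σ ^ 2) + c) = (1 + 2 * σ ^ 2 * c) / (2 * σ ^ 2) := by field_simp
    rw [this]
    field_simp
  rw [← h2]
  linear_combination ((2 * Real.pi * σ ^ 2)⁻¹ *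
    Real.exp (-(γ * (2 * σ ^ 2 * c / (1 + 2 * σ ^ 2 * c))))) * h1

theorem isProbabilityMeasure_ricianLaw {γ σ : ℝ} (hγ : 0 ≤ γ) (hσ : 0 < σ) :
    IsProbabilityMeasure (ricianLaw γ σ) := by
  constructor
  simpa [ricianLaplace] using lintegral_ricianLaw_exp hγ hσ le_rfl

theorem ricianLaplace_pos (γ : ℝ) {σ c : ℝ} (hc : 0 ≤ c) : 0 < ricianLaplace γ σ c := by
  unfold ricianLaplace
  positivity

theorem ricianLaplace_le_one {γ σ c : ℝ} (hγ : 0 ≤ γ) (hc : 0 ≤ c) : ricianLaplace γ σ c ≤ 1 := by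
  unfold ricianLaplace
  refine mul_le_one₀ (inv_le_one_of_one_le₀ ?_) (by positivity) (Real.exp_le_one_iff.2 ?_)
  · have : 0 ≤ 2 * σ ^ 2 * c := by positivity
    linarith
  · have : 0 ≤ γ * (2 * σ ^ 2 * c / (1 + 2 * σ ^ 2 * c)) := by positivity
    linarith

/-- Used for decay in `E_b/N₀`: `c` is proportional to the signal-to-noise ratio, and each position
contributes one inverse power. -/
theorem ricianLaplace_le_inv {γ σ c : ℝ} (hγ : 0 ≤ γ) (hσ : 0 < σ) (hc : 0 < c) :
    ricianLaplace γ σ c ≤ (2 * σ ^ 2 * c)⁻¹ := by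
  unfold ricianLaplace
  have h : 0 < 2 * σ ^ 2 * c := by positivity
  have h1 : Real.exp (-(γ * (2 * σ ^ 2 * c / (1 + 2 * σ ^ 2 * c)))) ≤ 1 := by
    rw [Real.exp_le_one_iff]
    have : 0 ≤ γ * (2 * σ ^ 2 * c / (1 + 2 * σ ^ 2 * c)) := by positivity
    linarith
  refine (mul_le_of_le_one_right (by positivity) h1).trans ?_
  exact inv_anti₀ h (by linarith)

/-- Used for decay in `γ`: the prefactor is irrelevant to the exponent. -/
theorem ricianLaplace_le_exp {γ σ c : ℝ} (hc : 0 ≤ c) :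
    ricianLaplace γ σ c ≤ Real.exp (-(γ * (2 * σ ^ 2 * c / (1 + 2 * σ ^ 2 * c)))) := by
  unfold ricianLaplace
  refine mul_le_of_le_one_left (by positivity) (inv_le_one_of_one_le₀ ?_)
  have : 0 ≤ 2 * σ ^ 2 * c := by positivity
  linarith

end Rician

/-! ### Chernoff bounds on the channel -/

section Chernoff

theorem lintegral_pi_prod {ι : Type*} [Fintype ι] (μ : Measure ℝ) [IsProbabilityMeasure μ]
    {f : ι → ℝ → ℝ≥0∞} (hf : ∀ i, Measurable (f i)) :
    ∫⁻ x, ∏ i, f i (x i) ∂(Measure.pi fun _ : ι => μ) = ∏ i, ∫⁻ a, f i a ∂μ := by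
  have h := lintegral_prod_eq_prod_lintegral_of_indepFun (μ := Measure.pi fun _ : ι => μ)
    Finset.univ (fun i x => f i (x i)) (iIndepFun_pi fun i => (hf i).aemeasurable)
    (fun i => (hf i).comp (measurable_pi_apply i))
  rw [h]
  refine Finset.prod_congr rfl fun i _ => ?_
  exact (measurePreserving_eval (fun _ : ι => μ) i).lintegral_comp (hf i)

theorem lintegral_gaussianReal_exp (v : NNReal) (a : ℝ) :
    ∫⁻ z, ENNReal.ofReal (Real.exp (a * z)) ∂gaussianReal 0 v =
      ENNReal.ofReal (Real.exp (v * a ^ 2 / 2)) := by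
  rw [← ofReal_integral_eq_lintegral_ofReal (integrable_exp_mul_gaussianReal a)
    (ae_of_all _ fun x => by positivity)]
  have := congrFun (mgf_id_gaussianReal (μ := 0) (v := v)) a
  simp only [mgf, id, zero_mul, zero_add] at this
  rw [this]

variable {k n : ℕ} (G : Matrix (Fin k) (Fin n) (ZMod 2)[X]) (H : ℕ)

/-- Given the envelopes, the Gaussian moment generating function turns the term linear in the noise
into `N₀/4 · a² α²`. What remains is a product of Rician transforms, at nonnegative arguments by
`hab`. -/
theorem lintegral_channelLaw_exp {γ σ N₀ : ℝ} (hγ : 0 ≤ γ) (hσ : 0 < σ) (hN : 0 < N₀)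
    (a b : SymIdx G H → ℝ) (hab : ∀ p, N₀ / 4 * a p ^ 2 ≤ b p) :
    ∫⁻ ω, ENNReal.ofReal (Real.exp (∑ p, (a p * ω.1 p * ω.2 p - b p * ω.1 p ^ 2)))
        ∂channelLaw G H γ σ N₀ =
      ∏ p, ENNReal.ofReal (ricianLaplace γ σ (b p - N₀ / 4 * a p ^ 2)) := by
  have := isProbabilityMeasure_ricianLaw hγ hσ
  have hv : (((N₀ / 2).toNNReal : NNReal) : ℝ) = N₀ / 2 := Real.coe_toNNReal _ (by positivity)
  rw [channelLaw, lintegral_prod _ (Measurable.aemeasurable (by fun_prop))]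
  have h1 : ∀ α : SymIdx G H → ℝ,
      ∫⁻ z, ENNReal.ofReal (Real.exp (∑ p, (a p * α p * z p - b p * α p ^ 2)))
        ∂(Measure.pi fun _ : SymIdx G H => gaussianReal 0 (N₀ / 2).toNNReal) =
      ∏ p, ENNReal.ofReal (Real.exp (-(b p - N₀ / 4 * a p ^ 2) * α p ^ 2)) := by
    intro α
    have h2 : ∀ z : SymIdx G H → ℝ,
        ENNReal.ofReal (Real.exp (∑ p, (a p * α p * z p - b p * α p ^ 2))) =
        ∏ p, ENNReal.ofReal (Real.exp (-(b p * α p ^ 2))) *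
          ENNReal.ofReal (Real.exp (a p * α p * z p)) := by
      intro z
      rw [Real.exp_sum, ENNReal.ofReal_prod_of_nonneg fun p _ => (Real.exp_nonneg _)]
      refine Finset.prod_congr rfl fun p _ => ?_
      rw [← ENNReal.ofReal_mul (Real.exp_nonneg _), ← Real.exp_add]
      ring_nf
    simp_rw [h2]
    rw [lintegral_pi_prod (gaussianReal 0 (N₀ / 2).toNNReal) (f := fun p z =>
      ENNReal.ofReal (Real.exp (-(b p * α p ^ 2))) *
          ENNReal.ofReal (Real.exp (a p * α p * z))) (fun p => by fun_prop)]
    refine Finset.prod_congr rfl fun p _ => ?_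
    rw [lintegral_const_mul _ (by fun_prop), lintegral_gaussianReal_exp,
      ← ENNReal.ofReal_mul (Real.exp_nonneg _), ← Real.exp_add, hv]
    ring_nf
  simp_rw [h1]
  rw [lintegral_pi_prod (ricianLaw γ σ) (f := fun p x =>
      ENNReal.ofReal (Real.exp (-(b p - N₀ / 4 * a p ^ 2) * x ^ 2))) (fun p => by fun_prop)]
  exact Finset.prod_congr rfl fun p _ =>
    lintegral_ricianLaw_exp hγ hσ (by linarith [hab p])

/-- Chernoff bound for the quadratic forms that decide the comparisons of the decoder. -/
theorem channelLaw_le_of_exponent {γ σ N₀ : ℝ} (hγ : 0 ≤ γ) (hσ : 0 < σ) (hN : 0 < N₀)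
    {a b : SymIdx G H → ℝ} {c L : ℝ} (hc : 0 ≤ c) {S : Finset (SymIdx G H)}
    (hab : ∀ p, N₀ / 4 * a p ^ 2 ≤ b p) (hS : ∀ p ∈ S, N₀ / 4 * a p ^ 2 + c ≤ b p)
    {E : Set ((SymIdx G H → ℝ) × (SymIdx G H → ℝ))}
    (hE : ∀ ω ∈ E, L ≤ ∑ p, (a p * ω.1 p * ω.2 p - b p * ω.1 p ^ 2)) :
    channelLaw G H γ σ N₀ E ≤ ENNReal.ofReal (Real.exp (-L) * ricianLaplace γ σ c ^ S.card) := by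
  classical
  -- Lowering the quadratic coefficients only enlarges the integrand, and makes the factors exactly
  -- the transform at `c` on `S` and `1` elsewhere.
  set b' : SymIdx G H → ℝ := fun p => N₀ / 4 * a p ^ 2 + if p ∈ S then c else 0 with hb'
  have hle : ∀ p, b' p ≤ b p := by
    intro p
    simp only [hb']
    split_ifs with h
    · exact hS p h
    · simpa using hab p
  have hE' : E ⊆ {ω | 1 ≤ ENNReal.ofReal (Real.exp (-L)) * ENNReal.ofReal (Real.exp
      (∑ p, (a p * ω.1 p * ω.2 p - b' p * ω.1 p ^ 2)))} := by
    intro ω hω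
    have h1 := hE ω hω
    have h2 : ∑ p, (a p * ω.1 p * ω.2 p - b p * ω.1 p ^ 2) ≤
        ∑ p, (a p * ω.1 p * ω.2 p - b' p * ω.1 p ^ 2) := by
      refine Finset.sum_le_sum fun p _ => ?_
      have := mul_le_mul_of_nonneg_right (hle p) (sq_nonneg (ω.1 p))
      linarith
    rw [Set.mem_ofPred_eq, ← ENNReal.ofReal_mul (Real.exp_nonneg _), ← Real.exp_add,
      ENNReal.one_le_ofReal]
    exact Real.one_le_exp (by linarith)
  refine (measure_mono hE').trans ?_
  have hmark := mul_meas_ge_le_lintegral (μ := channelLaw G H γ σ N₀)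
    (f := fun ω => ENNReal.ofReal (Real.exp (-L)) * ENNReal.ofReal (Real.exp
      (∑ p, (a p * ω.1 p * ω.2 p - b' p * ω.1 p ^ 2)))) (by fun_prop) 1
  rw [one_mul] at hmark
  refine hmark.trans ?_
  rw [lintegral_const_mul _ (by fun_prop), lintegral_channelLaw_exp G H hγ hσ hN a b' (fun p => by
    simp only [hb']; split_ifs <;> linarith), ENNReal.ofReal_mul (Real.exp_nonneg _)]
  gcongr
  rw [ENNReal.ofReal_pow (ricianLaplace_pos γ hc).le, ← Finset.prod_const,
    ← Finset.prod_subset (Finset.subset_univ S) (f := fun p =>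
      ENNReal.ofReal (ricianLaplace γ σ (b' p - N₀ / 4 * a p ^ 2)))]
  · refine (Finset.prod_congr rfl fun p hp => ?_).le
    simp [hb', hp]
  · intro p _ hp
    simp [hb', hp, ricianLaplace]

end Chernoff

/-! ### Pairwise error events -/

section Pairwise

variable {k n : ℕ} (G : Matrix (Fin k) (Fin n) (ZMod 2)[X]) {H : ℕ}

/-- The amplitude signal-to-noise ratio `√(2 E_c / N₀)` of a code symbol. -/
def snr (H : ℕ) (Eb N₀ : ℝ) : ℝ := √(2 * codeEnergy G H Eb / N₀)

theorem snr_nonneg (Eb N₀ : ℝ) : 0 ≤ snr G H Eb N₀ := Real.sqrt_nonneg _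

theorem codeEnergy_nonneg {Eb : ℝ} (hE : 0 ≤ Eb) : 0 ≤ codeEnergy G H Eb := by
  unfold codeEnergy
  positivity

theorem sqrt_codeEnergy {Eb N₀ : ℝ} (hE : 0 ≤ Eb) (hN : 0 < N₀) :
    √(codeEnergy G H Eb) = snr G H Eb N₀ * √(N₀ / 2) := by
  have := codeEnergy_nonneg G (H := H) hE
  rw [snr, ← Real.sqrt_mul (by positivity)]
  congr 1
  field_simp

/-- Margins and metrics when `w` is sent, in units of the noise standard deviation. -/
theorem sum_received {Eb N₀ : ℝ} (hE : 0 ≤ Eb) (hN : 0 < N₀) (w : Msg k H)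
    (α z c : SymIdx G H → ℝ) :
    ∑ p, α p * c p * received G Eb w α z p = √(N₀ / 2) *
      ∑ p, (c p / √(N₀ / 2) * α p * z p + snr G H Eb N₀ * symbol G w p * c p * α p ^ 2) := by
  have hτ : √(N₀ / 2) ≠ 0 := (Real.sqrt_pos.2 (by positivity)).ne'
  rw [Finset.mul_sum]
  refine Finset.sum_congr rfl fun p _ => ?_
  rw [received, sqrt_codeEnergy G hE hN]
  field_simp
  ring

theorem filter_lt_length : (Finset.univ.filter fun p : SymIdx G H => (p.2 : ℕ) < H + memory G) =
    Finset.univ := by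
  ext p
  simp

theorem margin_received_iff {Eb N₀ : ℝ} (hE : 0 ≤ Eb) (hN : 0 < N₀) (u : ℝ) (w v r : Msg k H)
    (α z : SymIdx G H → ℝ) :
    Margin G N₀ u α (received G Eb w α z) (H + memory G) v r ↔
      0 ≤ ∑ p, ((symbol G v p - symbol G r p) / √(N₀ / 2) * α p * z p +
        (snr G H Eb N₀ * symbol G w p * (symbol G v p - symbol G r p) -
          u / freeDist G * |symbol G r p - symbol G v p|) * α p ^ 2) := by
  have hτ : 0 < √(N₀ / 2) := Real.sqrt_pos.2 (by positivity)
  rw [Margin, filter_lt_length, sum_received G hE hN]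
  have h1 : ∑ p, ((symbol G v p - symbol G r p) / √(N₀ / 2) * α p * z p +
        (snr G H Eb N₀ * symbol G w p * (symbol G v p - symbol G r p) -
          u / freeDist G * |symbol G r p - symbol G v p|) * α p ^ 2) =
      ∑ p, ((symbol G v p - symbol G r p) / √(N₀ / 2) * α p * z p +
        snr G H Eb N₀ * symbol G w p * (symbol G v p - symbol G r p) * α p ^ 2) -
      u / freeDist G * ∑ p, |symbol G r p - symbol G v p| * α p ^ 2 := by
    rw [Finset.mul_sum, ← Finset.sum_sub_distrib]
    exact Finset.sum_congr rfl fun p _ => by ring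
  rw [h1, sub_nonneg, mul_comm (u / (freeDist G : ℝ)), mul_assoc, mul_le_mul_iff_right₀ hτ]

theorem metric_le_iff_margin_zero (N₀ : ℝ) (α y : SymIdx G H → ℝ) (v r : Msg k H) :
    metric G α y (H + memory G) r ≤ metric G α y (H + memory G) v ↔
      Margin G N₀ 0 α y (H + memory G) v r := by
  rw [Margin, zero_div, zero_mul, zero_mul, ← sub_nonneg, metric, metric,
    ← Finset.sum_sub_distrib]
  have : ∀ p, α p * symbol G v p * y p - α p * symbol G r p * y p =
    α p * (symbol G v p - symbol G r p) * y p := fun p => by ring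
  simp_rw [this]

variable {γ σ Eb N₀ : ℝ}

theorem channelLaw_le_of_normalized (hγ : 0 ≤ γ) (hσ : 0 < σ) (hN : 0 < N₀)
    {A B : SymIdx G H → ℝ} {c L : ℝ} (hc : 0 ≤ c)
    {S : Finset (SymIdx G H)} (hAB : ∀ p, A p ^ 2 / 2 ≤ B p) (hS : ∀ p ∈ S, A p ^ 2 / 2 + c ≤ B p)
    {E : Set ((SymIdx G H → ℝ) × (SymIdx G H → ℝ))}
    (hE : ∀ ω ∈ E, L ≤ ∑ p, (A p / √(N₀ / 2) * ω.1 p * ω.2 p - B p * ω.1 p ^ 2)) :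
    channelLaw G H γ σ N₀ E ≤ ENNReal.ofReal (Real.exp (-L) * ricianLaplace γ σ c ^ S.card) := by
  have h : ∀ p, N₀ / 4 * (A p / √(N₀ / 2)) ^ 2 = A p ^ 2 / 2 := by
    intro p
    rw [div_pow, Real.sq_sqrt (by positivity)]
    ring_nf
    field_simp
  exact channelLaw_le_of_exponent G H hγ hσ hN hc (fun p => by rw [h]; exact hAB p)
    (fun p hp => by rw [h]; exact hS p hp) hE

/-- The event that `w` is sent, `r` is at least as likely, and `v` passes the test against `r`. -/
theorem channelLaw_margin_le (hγ : 0 ≤ γ) (hσ : 0 < σ) (hE : 0 ≤ Eb) (hN : 0 < N₀)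
    (u : ℝ) (hu : 0 ≤ u) (w v r : Msg k H) :
    channelLaw G H γ σ N₀ {ω | Margin G N₀ u ω.1 (received G Eb w ω.1 ω.2) (H + memory G) v r ∧
        metric G ω.1 (received G Eb w ω.1 ω.2) (H + memory G) w ≤
          metric G ω.1 (received G Eb w ω.1 ω.2) (H + memory G) r} ≤
      ENNReal.ofReal (ricianLaplace γ σ ((snr G H Eb N₀ + u / freeDist G) ^ 2 / 2) ^
        (diffSet G v r).card) := by
  have hq := snr_nonneg G (H := H) Eb N₀
  set q := snr G H Eb N₀ with hqdef
  set f := u / (freeDist G : ℝ) with hf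
  have hf0 : 0 ≤ f := by positivity
  -- The multipliers `(q + f)/2` for the test and `q` for the metric comparison make `B - A²/2`
  -- equal to `(q + f)²/2` wherever `v` and `r` differ, whatever was sent, and `0` where they agree.
  -- The bound is thus the same as if `r` had been sent.
  set A : SymIdx G H → ℝ := fun p => (q + f) / 2 * (symbol G v p - symbol G r p) +
    q * (symbol G r p - symbol G w p) with hA
  set B : SymIdx G H → ℝ := fun p => (q + f) / 2 * f * |symbol G r p - symbol G v p| -
    q * symbol G w p * A p with hB
  have key : ∀ p, A p ^ 2 / 2 ≤ B p ∧ (p ∈ diffSet G v r → A p ^ 2 / 2 + (q + f) ^ 2 / 2 ≤ B p) := by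
    intro p
    rw [mem_diffSet]
    simp only [hB, hA]
    rcases symbol_eq_or G w p with h1 | h1 <;> rcases symbol_eq_or G v p with h2 | h2 <;>
      rcases symbol_eq_or G r p with h3 | h3 <;> rw [h1, h2, h3] <;>
      norm_num [abs_of_pos, abs_of_neg] <;> (try constructor) <;> nlinarith
  have := channelLaw_le_of_normalized G hγ hσ hN (A := A) (B := B) (c := (q + f) ^ 2 / 2) (L := 0)
    (S := diffSet G v r) (by positivity) (fun p => (key p).1) (fun p => (key p).2)
    (E := {ω | Margin G N₀ u ω.1 (received G Eb w ω.1 ω.2) (H + memory G) v r ∧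
        metric G ω.1 (received G Eb w ω.1 ω.2) (H + memory G) w ≤
          metric G ω.1 (received G Eb w ω.1 ω.2) (H + memory G) r}) ?_
  · simpa using this
  · rintro ω ⟨h1, h2⟩
    rw [margin_received_iff G hE hN] at h1
    rw [metric_le_iff_margin_zero G N₀, margin_received_iff G hE hN] at h2
    have h3 := add_nonneg (mul_nonneg (by positivity : 0 ≤ (q + f) / 2) h1) (mul_nonneg hq h2)
    rw [Finset.mul_sum, Finset.mul_sum, ← Finset.sum_add_distrib] at h3
    refine h3.trans (le_of_eq (Finset.sum_congr rfl fun p _ => ?_))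
    simp only [hB, hA, ← hqdef, ← hf]
    ring

/-- The event that `w` is sent and two other messages are at least as likely. -/
theorem channelLaw_two_rivals_le (hγ : 0 ≤ γ) (hσ : 0 < σ) (hE : 0 ≤ Eb) (hN : 0 < N₀)
    (w v v' : Msg k H) :
    channelLaw G H γ σ N₀ {ω | metric G ω.1 (received G Eb w ω.1 ω.2) (H + memory G) w ≤
          metric G ω.1 (received G Eb w ω.1 ω.2) (H + memory G) v ∧
        metric G ω.1 (received G Eb w ω.1 ω.2) (H + memory G) w ≤
          metric G ω.1 (received G Eb w ω.1 ω.2) (H + memory G) v'} ≤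
      ENNReal.ofReal (ricianLaplace γ σ (3 / 8 * snr G H Eb N₀ ^ 2) ^
        (diffSet G w v ∪ diffSet G w v').card) := by
  have hq := snr_nonneg G (H := H) Eb N₀
  set q := snr G H Eb N₀ with hqdef
  -- With multiplier `q/4` for each rival, `B - A²/2` is `3/8 q²` where exactly one of them differs
  -- from `w` and `q²/2` where both do. The smaller value serves on the whole union.
  set A : SymIdx G H → ℝ := fun p => q / 4 * (symbol G v p - symbol G w p) +
    q / 4 * (symbol G v' p - symbol G w p) with hA
  set B : SymIdx G H → ℝ := fun p => - (q * symbol G w p * A p) with hB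
  have key : ∀ p, A p ^ 2 / 2 ≤ B p ∧
      (p ∈ diffSet G w v ∪ diffSet G w v' → A p ^ 2 / 2 + 3 / 8 * q ^ 2 ≤ B p) := by
    intro p
    rw [Finset.mem_union, mem_diffSet, mem_diffSet]
    simp only [hB, hA]
    rcases symbol_eq_or G w p with h1 | h1 <;> rcases symbol_eq_or G v p with h2 | h2 <;>
      rcases symbol_eq_or G v' p with h3 | h3 <;> rw [h1, h2, h3] <;>
      norm_num <;> (try constructor) <;> nlinarith
  have := channelLaw_le_of_normalized G hγ hσ hN (A := A) (B := B) (c := 3 / 8 * q ^ 2) (L := 0)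
    (S := diffSet G w v ∪ diffSet G w v') (by positivity) (fun p => (key p).1)
    (fun p => (key p).2)
    (E := {ω | metric G ω.1 (received G Eb w ω.1 ω.2) (H + memory G) w ≤
          metric G ω.1 (received G Eb w ω.1 ω.2) (H + memory G) v ∧
        metric G ω.1 (received G Eb w ω.1 ω.2) (H + memory G) w ≤
          metric G ω.1 (received G Eb w ω.1 ω.2) (H + memory G) v'}) ?_
  · simpa using this
  · rintro ω ⟨h1, h2⟩
    rw [metric_le_iff_margin_zero G N₀, margin_received_iff G hE hN] at h1 h2
    have h3 := add_nonneg (mul_nonneg (by positivity : 0 ≤ q / 4) h1)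
      (mul_nonneg (by positivity : 0 ≤ q / 4) h2)
    rw [Finset.mul_sum, Finset.mul_sum, ← Finset.sum_add_distrib] at h3
    refine h3.trans (le_of_eq (Finset.sum_congr rfl fun p _ => ?_))
    simp only [hB, hA, ← hqdef]
    ring

/-- The event that the sent message does not pass the test against `v`. -/
theorem channelLaw_not_margin_le (hγ : 0 ≤ γ) (hσ : 0 < σ) (hE : 0 ≤ Eb) (hN : 0 < N₀)
    (u : ℝ) (hu : u / freeDist G ≤ snr G H Eb N₀) (w v : Msg k H) :
    channelLaw G H γ σ N₀
        {ω | ¬ Margin G N₀ u ω.1 (received G Eb w ω.1 ω.2) (H + memory G) w v} ≤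
      ENNReal.ofReal (ricianLaplace γ σ ((snr G H Eb N₀ - u / freeDist G) ^ 2 / 2) ^
        (diffSet G w v).card) := by
  set q := snr G H Eb N₀ with hqdef
  set f := u / (freeDist G : ℝ) with hf
  -- The failed test is reversed and weighted by `(q - f)/2`, nonnegative by `hu`. This leaves `(q -
  -- f)²/2` at each differing position.
  set A : SymIdx G H → ℝ := fun p => -((q - f) / 2 * (symbol G w p - symbol G v p)) with hA
  set B : SymIdx G H → ℝ := fun p =>
    (q - f) / 2 * (q * symbol G w p * (symbol G w p - symbol G v p) -
      f * |symbol G v p - symbol G w p|) with hB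
  have key : ∀ p, A p ^ 2 / 2 ≤ B p ∧ (p ∈ diffSet G w v → A p ^ 2 / 2 + (q - f) ^ 2 / 2 ≤ B p) := by
    intro p
    rw [mem_diffSet]
    simp only [hB, hA]
    rcases symbol_eq_or G w p with h1 | h1 <;> rcases symbol_eq_or G v p with h2 | h2 <;>
      rw [h1, h2] <;>
      norm_num [abs_of_pos, abs_of_neg] <;> (try constructor) <;> nlinarith
  have := channelLaw_le_of_normalized G hγ hσ hN (A := A) (B := B) (c := (q - f) ^ 2 / 2) (L := 0)
    (S := diffSet G w v) (by positivity) (fun p => (key p).1) (fun p => (key p).2)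
    (E := {ω | ¬ Margin G N₀ u ω.1 (received G Eb w ω.1 ω.2) (H + memory G) w v}) ?_
  · simpa using this
  · intro ω h1
    rw [Set.mem_ofPred_eq, margin_received_iff G hE hN, not_le] at h1
    have h3 := mul_nonneg (by linarith : 0 ≤ (q - f) / 2) (neg_nonneg.2 h1.le)
    rw [← Finset.sum_neg_distrib, Finset.mul_sum] at h3
    refine h3.trans (le_of_eq (Finset.sum_congr rfl fun p _ => ?_))
    simp only [hB, hA, ← hqdef, ← hf]
    ring

end Pairwise

/-! ### Union bounds -/

section Union

variable {k n : ℕ} (G : Matrix (Fin k) (Fin n) (ZMod 2)[X]) {H : ℕ} {γ σ Eb N₀ : ℝ}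

/-- The event that a message with a wrong bit `(h, a)` is accepted when `w` is sent. -/
def bitErrorEvent (Eb N₀ u : ℝ) (w : Msg k H) (h : Fin H) (a : Fin k) :
    Set ((SymIdx G H → ℝ) × (SymIdx G H → ℝ)) :=
  {ω | ∃ w' : Msg k H, Accepts G N₀ u ω.1 (received G Eb w ω.1 ω.2) w' ∧ w' h a ≠ w h a}

theorem bitErrorProb_le {u : ℝ} {X : ℝ≥0∞}
    (h : ∀ w h a, channelLaw G H γ σ N₀ (bitErrorEvent G Eb N₀ u w h a) ≤ X) :
    bitErrorProb G H γ σ Eb N₀ u ≤ X := by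
  unfold bitErrorProb
  refine ENNReal.div_le_of_le_mul ?_
  refine (Finset.sum_le_sum fun w _ => Finset.sum_le_sum fun h' _ =>
    Finset.sum_le_sum fun a _ => h w h' a).trans (le_of_eq ?_)
  simp only [Finset.sum_const, Finset.card_univ, nsmul_eq_mul, Fintype.card_fin]
  ring

theorem retransProb_le {u : ℝ} {X : ℝ≥0∞}
    (h : ∀ w : Msg k H, channelLaw G H γ σ N₀
      {ω | Retransmits G H N₀ u ω.1 (received G Eb w ω.1 ω.2)} ≤ X) :
    retransProb G H γ σ Eb N₀ u ≤ X := by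
  unfold retransProb
  refine ENNReal.div_le_of_le_mul ?_
  refine (Finset.sum_le_sum fun w _ => h w).trans (le_of_eq ?_)
  simp only [Finset.sum_const, Finset.card_univ, nsmul_eq_mul]
  ring

theorem ricianLaplace_pow_le (hγ : 0 ≤ γ) {c : ℝ} (hc : 0 ≤ c) {d d' : ℕ} (h : d ≤ d') :
    ricianLaplace γ σ c ^ d' ≤ ricianLaplace γ σ c ^ d :=
  pow_le_pow_of_le_one (ricianLaplace_pos γ hc).le (ricianLaplace_le_one hγ hc) h

theorem channelLaw_bitErrorEvent_le (hγ : 0 ≤ γ) (hσ : 0 < σ) (hE : 0 ≤ Eb) (hN : 0 < N₀) {u : ℝ}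
    (hu : 0 ≤ u) (w : Msg k H) (h : Fin H) (a : Fin k) :
    channelLaw G H γ σ N₀ (bitErrorEvent G Eb N₀ u w h a) ≤
      ENNReal.ofReal ((Fintype.card (Msg k H) : ℝ) ^ 2 *
        ricianLaplace γ σ ((snr G H Eb N₀ + u / freeDist G) ^ 2 / 2) ^ freeDist G) := by
  set X := ricianLaplace γ σ ((snr G H Eb N₀ + u / freeDist G) ^ 2 / 2) ^ freeDist G with hX
  have hsub : bitErrorEvent G Eb N₀ u w h a ⊆ ⋃ v : Msg k H, ⋃ r : Msg k H,
      {ω | v ≠ r ∧ Margin G N₀ u ω.1 (received G Eb w ω.1 ω.2) (H + memory G) v r ∧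
        metric G ω.1 (received G Eb w ω.1 ω.2) (H + memory G) w ≤
          metric G ω.1 (received G Eb w ω.1 ω.2) (H + memory G) r} := by
    rintro ω ⟨v, hv, hne⟩
    obtain ⟨r, h1, h2, h3⟩ := hv.exists_margin (w := w) (fun heq => hne (by rw [heq]))
    exact Set.mem_iUnion₂.2 ⟨v, r, h1.symm, h2, h3⟩
  have hle : ∀ v r : Msg k H, channelLaw G H γ σ N₀
      {ω | v ≠ r ∧ Margin G N₀ u ω.1 (received G Eb w ω.1 ω.2) (H + memory G) v r ∧
        metric G ω.1 (received G Eb w ω.1 ω.2) (H + memory G) w ≤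
          metric G ω.1 (received G Eb w ω.1 ω.2) (H + memory G) r} ≤ ENNReal.ofReal X := by
    intro v r
    by_cases hvr : v = r
    · simp [hvr]
    · simp only [ne_eq, hvr, not_false_eq_true, true_and]
      exact (channelLaw_margin_le G hγ hσ hE hN u hu w v r).trans (ENNReal.ofReal_le_ofReal
        (ricianLaplace_pow_le hγ (by positivity) (freeDist_le_card_diffSet hvr)))
  calc channelLaw G H γ σ N₀ (bitErrorEvent G Eb N₀ u w h a)
      ≤ ∑ v : Msg k H, ∑ r : Msg k H, ENNReal.ofReal X :=
        (measure_mono hsub).trans ((measure_iUnion_fintype_le _ _).trans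
          (Finset.sum_le_sum fun v _ => (measure_iUnion_fintype_le _ _).trans
            (Finset.sum_le_sum fun r _ => hle v r)))
    _ = ENNReal.ofReal ((Fintype.card (Msg k H) : ℝ) ^ 2 * X) := by
        clear_value X
        rw [ENNReal.ofReal_mul (by positivity), ENNReal.ofReal_pow (by positivity),
          ENNReal.ofReal_natCast]
        simp only [Finset.sum_const, Finset.card_univ, nsmul_eq_mul]
        ring

theorem channelLaw_retransmits_le (hγ : 0 ≤ γ) (hσ : 0 < σ) (hE : 0 ≤ Eb) (hN : 0 < N₀) {u : ℝ}
    (hu : 0 ≤ u) (hu' : u / freeDist G ≤ snr G H Eb N₀) (w : Msg k H) :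
    channelLaw G H γ σ N₀ {ω | Retransmits G H N₀ u ω.1 (received G Eb w ω.1 ω.2)} ≤
      ENNReal.ofReal ((Fintype.card (Msg k H) : ℝ) *
        ricianLaplace γ σ ((snr G H Eb N₀ - u / freeDist G) ^ 2 / 2) ^ freeDist G) := by
  set X := ricianLaplace γ σ ((snr G H Eb N₀ - u / freeDist G) ^ 2 / 2) ^ freeDist G with hX
  have hsub : {ω : (SymIdx G H → ℝ) × (SymIdx G H → ℝ) |
      Retransmits G H N₀ u ω.1 (received G Eb w ω.1 ω.2)} ⊆ ⋃ v : Msg k H,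
      {ω | ¬ Margin G N₀ u ω.1 (received G Eb w ω.1 ω.2) (H + memory G) w v} := by
    intro ω hω
    by_contra hcon
    simp only [Set.mem_iUnion, not_exists, Set.mem_ofPred_eq, not_not] at hcon
    have hacc := accepts_of_forall_margin hu hcon
    exact hω w hacc.1 hacc.2
  have hle : ∀ v : Msg k H, channelLaw G H γ σ N₀
      {ω | ¬ Margin G N₀ u ω.1 (received G Eb w ω.1 ω.2) (H + memory G) w v} ≤
        ENNReal.ofReal X := by
    intro v
    by_cases hvr : w = v
    · subst hvr
      simp [Margin]
    · exact (channelLaw_not_margin_le G hγ hσ hE hN u hu' w v).trans (ENNReal.ofReal_le_ofReal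
        (ricianLaplace_pow_le hγ (by positivity) (freeDist_le_card_diffSet hvr)))
  calc channelLaw G H γ σ N₀ {ω | Retransmits G H N₀ u ω.1 (received G Eb w ω.1 ω.2)}
      ≤ ∑ v : Msg k H, ENNReal.ofReal X :=
        (measure_mono hsub).trans ((measure_iUnion_fintype_le _ _).trans
          (Finset.sum_le_sum fun v _ => hle v))
    _ = ENNReal.ofReal ((Fintype.card (Msg k H) : ℝ) * X) := by
        rw [ENNReal.ofReal_mul (by positivity), ENNReal.ofReal_natCast]
        simp only [Finset.sum_const, Finset.card_univ, nsmul_eq_mul]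

end Union

/-! ### Exponents with respect to the Rician factor -/

section Exponent

/-- The union-bound constant contributes only `log K / γ`, which vanishes in the limit. -/
theorem le_liminf_neg_log_div {P : ℝ → ℝ≥0∞} {K e : ℝ} (hK : 0 < K)
    (hP : ∀ γ, 0 < γ → P γ ≤ ENNReal.ofReal (K * Real.exp (-(γ * e)))) :
    (e : EReal) ≤ liminf (fun γ : ℝ => -ENNReal.log (P γ) / (γ : EReal)) atTop := by
  have hlim : Tendsto (fun γ : ℝ => ((e - Real.log K / γ : ℝ) : EReal)) atTop (𝓝 (e : EReal)) := by
    refine (continuous_coe_real_ereal.tendsto _).comp ?_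
    simpa using (tendsto_const_nhds (x := e)).sub (tendsto_const_nhds.div_atTop tendsto_id)
  rw [← hlim.liminf_eq]
  refine liminf_le_liminf ?_
  filter_upwards [eventually_gt_atTop 0] with γ hγ
  have h1 : ENNReal.log (P γ) ≤ ((Real.log K - γ * e : ℝ) : EReal) := by
    refine (ENNReal.log_monotone (hP γ hγ)).trans (le_of_eq ?_)
    rw [ENNReal.log_ofReal_of_pos (by positivity), Real.log_mul hK.ne' (Real.exp_ne_zero _),
      Real.log_exp]
    ring_nf
  have h2 : (((γ * e - Real.log K : ℝ)) : EReal) ≤ -ENNReal.log (P γ) := by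
    rw [EReal.le_neg]
    refine h1.trans (le_of_eq ?_)
    rw [← EReal.coe_neg]
    congr 1
    ring
  have h3 : ((e - Real.log K / γ : ℝ) : EReal) = ((γ * e - Real.log K : ℝ) : EReal) / (γ : EReal) := by
    rw [← EReal.coe_div]
    congr 1
    field_simp
  rw [h3]
  exact EReal.div_le_div_right_of_nonneg (by exact_mod_cast hγ.le) h2

variable {k n : ℕ} (G : Matrix (Fin k) (Fin n) (ZMod 2)[X]) {H : ℕ}

theorem hTilde_eq {σ : ℝ} (hσ : 0 < σ) (Eb N₀ u : ℝ) :
    hTilde G H σ Eb N₀ u = 2 * σ ^ 2 * ((snr G H Eb N₀ + u / freeDist G) ^ 2 / 2) /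
      (1 + 2 * σ ^ 2 * ((snr G H Eb N₀ + u / freeDist G) ^ 2 / 2)) := by
  unfold hTilde snr
  set x := √(2 * codeEnergy G H Eb / N₀) + u / freeDist G
  have : 1 + 2 * σ ^ 2 * (x ^ 2 / 2) ≠ 0 := by positivity
  have h2 : x ^ 2 + 1 / σ ^ 2 = (1 + 2 * σ ^ 2 * (x ^ 2 / 2)) / σ ^ 2 := by field_simp; ring
  rw [h2]
  field_simp
  ring

theorem ricianLaplace_pow_le_exp {γ σ : ℝ} (hσ : 0 < σ) (Eb N₀ u : ℝ) :
    ricianLaplace γ σ ((snr G H Eb N₀ + u / freeDist G) ^ 2 / 2) ^ freeDist G ≤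
      Real.exp (-(γ * (freeDist G * hTilde G H σ Eb N₀ u))) := by
  refine (pow_le_pow_left₀ (ricianLaplace_pos γ (by positivity)).le
    (ricianLaplace_le_exp (by positivity)) _).trans (le_of_eq ?_)
  rw [← Real.exp_nat_mul, hTilde_eq G hσ]
  congr 1
  ring

theorem le_liminf_bitErrorProb {σ Eb N₀ u : ℝ} (hσ : 0 < σ)
    (hE : 0 ≤ Eb) (hN : 0 < N₀) (hu : 0 ≤ u) :
    (((freeDist G : ℝ) * hTilde G H σ Eb N₀ u : ℝ) : EReal) ≤
      liminf (fun γ : ℝ => -ENNReal.log (bitErrorProb G H γ σ Eb N₀ u) / (γ : EReal)) atTop := by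
  refine le_liminf_neg_log_div (K := (Fintype.card (Msg k H) : ℝ) ^ 2) (by positivity)
    fun γ hγ => bitErrorProb_le G fun w h a =>
      (channelLaw_bitErrorEvent_le G hγ.le hσ hE hN hu w h a).trans
        (ENNReal.ofReal_le_ofReal ?_)
  gcongr
  exact ricianLaplace_pow_le_exp G hσ _ _ _

theorem le_liminf_retransProb (hG : 0 < freeDist G) {σ Eb N₀ u : ℝ} (hσ : 0 < σ)
    (hE : 0 ≤ Eb) (hN : 0 < N₀) (hu : 0 ≤ u) (hu' : u < freeDist G * snr G H Eb N₀) :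
    (((freeDist G : ℝ) * hTilde G H σ Eb N₀ (-u) : ℝ) : EReal) ≤
      liminf (fun γ : ℝ => -ENNReal.log (retransProb G H γ σ Eb N₀ u) / (γ : EReal)) atTop := by
  have hd : (0 : ℝ) < freeDist G := by exact_mod_cast hG
  refine le_liminf_neg_log_div (K := (Fintype.card (Msg k H) : ℝ)) (by positivity)
    fun γ hγ => retransProb_le G fun w =>
      (channelLaw_retransmits_le G hγ.le hσ hE hN hu
        (by rw [div_le_iff₀ hd]; linarith) w).trans (ENNReal.ofReal_le_ofReal ?_)
  gcongr
  have := ricianLaplace_pow_le_exp G (H := H) (γ := γ) hσ Eb N₀ (-u)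
  rwa [neg_div, ← sub_eq_add_neg] at this

end Exponent

/-! ### Decay with the signal-to-noise ratio -/

section Decay

variable {k n : ℕ} (G : Matrix (Fin k) (Fin n) (ZMod 2)[X]) {H : ℕ} {γ σ Eb N₀ : ℝ}

/-- The ratio of `2 E_c` to `E_b`. -/
def energyFactor (H : ℕ) : ℝ := 2 * ((H : ℝ) / ((H : ℝ) + (memory G : ℝ))) * ((k : ℝ) / (n : ℝ))

theorem energyFactor_pos (hG : 0 < freeDist G) (hH : 0 < H) : 0 < energyFactor G H := by
  obtain ⟨hk, hn⟩ := pos_of_freeDist_pos hG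
  unfold energyFactor
  positivity

theorem snr_eq (Eb N₀ : ℝ) : snr G H Eb N₀ = √(energyFactor G H * (Eb / N₀)) := by
  unfold snr energyFactor codeEnergy
  congr 1
  ring

theorem snr_sq (hE : 0 ≤ Eb) (hN : 0 < N₀) :
    snr G H Eb N₀ ^ 2 = energyFactor G H * (Eb / N₀) := by
  rw [snr_eq, Real.sq_sqrt]
  unfold energyFactor
  positivity

theorem ricianLaplace_pow_le_ratio (hG : 0 < freeDist G) (hH : 0 < H) (hγ : 0 ≤ γ) (hσ : 0 < σ)
    (hE : 0 < Eb) (hN : 0 < N₀) {c : ℝ} (hc : 0 < c) (d : ℕ) :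
    ricianLaplace γ σ (c * snr G H Eb N₀ ^ 2) ^ d ≤
      ((2 * σ ^ 2 * c * energyFactor G H) ^ d)⁻¹ * ((Eb / N₀) ^ d)⁻¹ := by
  have he := energyFactor_pos G hG hH
  rw [snr_sq G hE.le hN, ← mul_inv, ← mul_pow, ← inv_pow]
  have hpos : 0 < c * (energyFactor G H * (Eb / N₀)) := by positivity
  refine pow_le_pow_left₀ (ricianLaplace_pos γ hpos.le).le
    ((ricianLaplace_le_inv hγ hσ hpos).trans (le_of_eq ?_)) _
  ring_nf

theorem bitErrorProb_zero_le (hG : 0 < freeDist G) (hH : 0 < H) (hγ : 0 ≤ γ) (hσ : 0 < σ)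
    (hE : 0 < Eb) (hN : 0 < N₀) :
    bitErrorProb G H γ σ Eb N₀ 0 ≤ ENNReal.ofReal ((Fintype.card (Msg k H) : ℝ) ^ 2 *
      ((2 * σ ^ 2 * (1 / 2) * energyFactor G H) ^ freeDist G)⁻¹ *
        ((Eb / N₀) ^ freeDist G)⁻¹) := by
  refine bitErrorProb_le G fun w h a =>
      (channelLaw_bitErrorEvent_le G hγ hσ hE.le hN le_rfl w h a).trans
        (ENNReal.ofReal_le_ofReal ?_)
  rw [mul_assoc]
  gcongr
  have := ricianLaplace_pow_le_ratio G hG hH hγ hσ hE hN (c := 1 / 2) (by norm_num) (freeDist G)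
  rwa [one_div_mul_eq_div, ← add_zero (snr G H Eb N₀), ← zero_div (freeDist G : ℝ)] at this

/-- A flag equal to a fixed fraction `θ < 1` of its critical value leaves the effective amplitude
`(1 - θ) q`, so only the constant deteriorates. -/
theorem retransProb_le_ratio (hG : 0 < freeDist G) (hH : 0 < H) (hγ : 0 ≤ γ) (hσ : 0 < σ)
    (hE : 0 < Eb) (hN : 0 < N₀) {θ : ℝ} (hθ : 0 ≤ θ) (hθ1 : θ < 1) :
    retransProb G H γ σ Eb N₀ (θ * (freeDist G * snr G H Eb N₀)) ≤
      ENNReal.ofReal ((Fintype.card (Msg k H) : ℝ) *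
      ((2 * σ ^ 2 * ((1 - θ) ^ 2 / 2) * energyFactor G H) ^ freeDist G)⁻¹ *
        ((Eb / N₀) ^ freeDist G)⁻¹) := by
  have hq := snr_nonneg G (H := H) Eb N₀
  have hd : (0 : ℝ) < freeDist G := by exact_mod_cast hG
  have hdiv : θ * (freeDist G * snr G H Eb N₀) / freeDist G = θ * snr G H Eb N₀ := by
    field_simp
  refine retransProb_le G fun w =>
      (channelLaw_retransmits_le G hγ hσ hE.le hN (by positivity) (by
        rw [hdiv]; exact mul_le_of_le_one_left hq hθ1.le) w).trans (ENNReal.ofReal_le_ofReal ?_)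
  rw [mul_assoc, hdiv]
  gcongr
  have h1 : 0 < (1 - θ) := by linarith
  have := ricianLaplace_pow_le_ratio G hG hH hγ hσ hE hN (c := (1 - θ) ^ 2 / 2) (by positivity)
    (freeDist G)
  rwa [show (1 - θ) ^ 2 / 2 * snr G H Eb N₀ ^ 2 =
    (snr G H Eb N₀ - θ * snr G H Eb N₀) ^ 2 / 2 by ring] at this

end Decay

/-! ### Small envelopes -/

section Small

/-- The quotient of the Rician density by its argument. -/
def ricianQuot (γ σ a : ℝ) : ℝ :=
  1 / σ ^ 2 * Real.exp (-((a ^ 2 + (√(2 * γ) * σ) ^ 2) / (2 * σ ^ 2))) *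
    besselI0 (a * (√(2 * γ) * σ) / σ ^ 2)

theorem continuous_ricianQuot (γ σ : ℝ) : Continuous (ricianQuot γ σ) := by
  have := continuous_besselI0
  unfold ricianQuot
  fun_prop

theorem ricianQuot_zero_pos (γ : ℝ) {σ : ℝ} (hσ : 0 < σ) : 0 < ricianQuot γ σ 0 := by
  unfold ricianQuot
  rw [zero_mul, zero_div, besselI0_zero]
  positivity

theorem ricianPDF_eq_mul {γ σ a : ℝ} (ha : 0 ≤ a) :
    ricianPDF (√(2 * γ) * σ) σ a = a * ricianQuot γ σ a := by
  rw [ricianPDF, if_pos ha, ricianQuot]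
  ring

theorem ricianPDF_of_nonpos {s σ a : ℝ} (ha : a ≤ 0) : ricianPDF s σ a = 0 := by
  unfold ricianPDF
  split_ifs with h
  · rw [le_antisymm ha h]
    simp
  · rfl

/-- Stretching by `κ` multiplies the density near zero by about `κ⁻²`. -/
theorem exists_ricianPDF_scale_le (γ : ℝ) {σ κ t : ℝ} (hσ : 0 < σ) (hκ : 0 < κ)
    (ht : (κ ^ 2)⁻¹ < t) : ∃ δ > 0, ∀ a ≤ δ,
      κ⁻¹ * ricianPDF (√(2 * γ) * σ) σ (κ⁻¹ * a) ≤ t * ricianPDF (√(2 * γ) * σ) σ a := by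
  -- This is the difference of the two sides divided by `a`. At `0` both quotients take the same
  -- positive value, so `t > κ⁻²` makes it positive near `0`.
  have hcont : Continuous fun a => t * ricianQuot γ σ a - (κ ^ 2)⁻¹ * ricianQuot γ σ (κ⁻¹ * a) := by
    have := continuous_ricianQuot γ σ
    fun_prop
  have h0 : 0 < t * ricianQuot γ σ 0 - (κ ^ 2)⁻¹ * ricianQuot γ σ (κ⁻¹ * 0) := by
    rw [mul_zero, ← sub_mul]
    exact mul_pos (sub_pos.2 ht) (ricianQuot_zero_pos γ hσ)
  have hev := (hcont.tendsto 0).eventually (lt_mem_nhds h0)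
  obtain ⟨δ, hδ, h⟩ := Metric.eventually_nhds_iff.1 hev
  refine ⟨δ / 2, by positivity, fun a ha => ?_⟩
  rcases le_or_gt a 0 with ha0 | ha0
  · rw [ricianPDF_of_nonpos ha0, ricianPDF_of_nonpos
      (mul_nonpos_of_nonneg_of_nonpos (by positivity) ha0)]
    simp
  · have := h (y := a) (by rw [Real.dist_eq, sub_zero, abs_of_pos ha0]; linarith)
    rw [ricianPDF_eq_mul ha0.le, ricianPDF_eq_mul (by positivity)]
    have h2 := mul_nonneg ha0.le this.le
    have h3 : κ⁻¹ * (κ⁻¹ * a * ricianQuot γ σ (κ⁻¹ * a)) =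
        a * ((κ ^ 2)⁻¹ * ricianQuot γ σ (κ⁻¹ * a)) := by
      rw [← inv_pow]
      ring
    rw [h3]
    linarith

/-- The stretched envelope `κ α` has density `κ⁻¹ f (κ⁻¹ a)`, so the pointwise inequality integrates
to one between measures. -/
theorem map_mul_ricianLaw_restrict_le {γ σ κ t δ : ℝ} (hκ : 0 < κ) (ht : 0 ≤ t)
    (h : ∀ a ≤ δ, κ⁻¹ * ricianPDF (√(2 * γ) * σ) σ (κ⁻¹ * a) ≤
      t * ricianPDF (√(2 * γ) * σ) σ a) :
    ((ricianLaw γ σ).map (κ * ·)).restrict (Set.Iic δ) ≤ t.toNNReal • ricianLaw γ σ := by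
  set f := ricianPDF (√(2 * γ) * σ) σ with hf
  have hfm : Measurable f := measurable_ricianPDF _ _
  refine Measure.le_iff.2 fun A hA => ?_
  have hAI := hA.inter (measurableSet_Iic (a := δ))
  rw [Measure.restrict_apply hA, Measure.map_apply (measurable_const_mul κ) hAI,
    Measure.smul_apply, ricianLaw, withDensity_apply _ (measurable_const_mul κ hAI),
    withDensity_apply _ hA, ← lintegral_indicator (measurable_const_mul κ hAI)]
  have h1 : ∀ a, ((κ * ·) ⁻¹' (A ∩ Set.Iic δ)).indicator (fun a => ENNReal.ofReal (f a)) a =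
      (A ∩ Set.Iic δ).indicator (fun b => ENNReal.ofReal (f (κ⁻¹ * b))) (κ * a) := by
    intro a
    by_cases ha : κ * a ∈ A ∩ Set.Iic δ
    · rw [Set.indicator_of_mem ha, Set.indicator_of_mem (s := (κ * ·) ⁻¹' (A ∩ Set.Iic δ)) ha,
        inv_mul_cancel_left₀ hκ.ne']
    · rw [Set.indicator_of_notMem ha, Set.indicator_of_notMem (s := (κ * ·) ⁻¹' (A ∩ Set.Iic δ)) ha]
  refine (lintegral_congr h1).le.trans ?_
  rw [← lintegral_map (f := (A ∩ Set.Iic δ).indicator (fun b => ENNReal.ofReal (f (κ⁻¹ * b))))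
    (Measurable.indicator (by fun_prop) hAI) (measurable_const_mul κ),
    Real.map_volume_mul_left hκ.ne', lintegral_smul_measure, lintegral_indicator hAI,
    abs_of_pos (inv_pos.2 hκ), smul_eq_mul, ← lintegral_const_mul _ (by fun_prop)]
  have h2 : ∫⁻ a in A ∩ Set.Iic δ, ENNReal.ofReal κ⁻¹ * ENNReal.ofReal (f (κ⁻¹ * a)) ≤
      ∫⁻ a in A ∩ Set.Iic δ, (t.toNNReal : ℝ≥0∞) * ENNReal.ofReal (f a) := by
    refine setLIntegral_mono (by fun_prop) fun a ha => ?_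
    rw [← ENNReal.ofReal_mul (inv_pos.2 hκ).le,
      show ((t.toNNReal : NNReal) : ℝ≥0∞) = ENNReal.ofReal t from rfl, ← ENNReal.ofReal_mul ht]
    exact ENNReal.ofReal_le_ofReal (h a ha.2)
  refine h2.trans ((lintegral_mono_set Set.inter_subset_left).trans (le_of_eq ?_))
  rw [lintegral_const_mul _ (by fun_prop)]
  rfl

/-- The Rician law of small intervals is at least quadratic in their length. -/
theorem exists_le_ricianLaw_Ioc (γ : ℝ) {σ : ℝ} (hσ : 0 < σ) :
    ∃ c > 0, ∃ δ > 0, ∀ r, 0 < r → r ≤ δ →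
      ENNReal.ofReal (c * r ^ 2) ≤ ricianLaw γ σ (Set.Ioc (r / 2) r) := by
  have h0 := ricianQuot_zero_pos γ hσ
  have hev := ((continuous_ricianQuot γ σ).tendsto 0).eventually
    (lt_mem_nhds (half_lt_self h0))
  obtain ⟨δ, hδ, h⟩ := Metric.eventually_nhds_iff.1 hev
  set c := ricianQuot γ σ 0 / 2 with hc
  -- On `(r/2, r]`, an interval of length `r/2`, the density is at least `c r/2`.
  refine ⟨c / 4, by positivity, δ / 2, by positivity, fun r hr hrδ => ?_⟩
  rw [ricianLaw, withDensity_apply _ measurableSet_Ioc]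
  have h1 : ∫⁻ _ in Set.Ioc (r / 2) r, ENNReal.ofReal (r / 2 * c) ≤
      ∫⁻ a in Set.Ioc (r / 2) r, ENNReal.ofReal (ricianPDF (√(2 * γ) * σ) σ a) := by
    refine setLIntegral_mono ((measurable_ricianPDF _ _).ennreal_ofReal) fun a ha => ?_
    have ha0 : 0 < a := lt_trans (by positivity) ha.1
    rw [ricianPDF_eq_mul ha0.le]
    refine ENNReal.ofReal_le_ofReal (mul_le_mul ha.1.le (h ?_).le (by positivity) ha0.le)
    rw [Real.dist_eq, sub_zero, abs_of_pos ha0]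
    linarith [ha.2]
  refine le_trans (le_of_eq ?_) h1
  rw [setLIntegral_const, Real.volume_Ioc, ← ENNReal.ofReal_mul (by positivity)]
  congr 1
  ring

end Small

/-! ### Product measures -/

section Product

/-- The product of the `ν i` comes from the largest outer measure bounded on boxes by the products
of their values, and the product of the `μ i` obeys that bound. -/
theorem pi_mono_measure {ι : Type*} [Fintype ι] {μ ν : ι → Measure ℝ} [∀ i, SigmaFinite (μ i)]
    [∀ i, SigmaFinite (ν i)] (h : ∀ i, μ i ≤ ν i) : Measure.pi μ ≤ Measure.pi ν := by
  have hout : (Measure.pi μ).toOuterMeasure ≤ OuterMeasure.pi fun i => (ν i).toOuterMeasure := by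
    rw [OuterMeasure.le_pi]
    intro s _
    show Measure.pi μ (Set.pi Set.univ s) ≤ ∏ i, ν i (s i)
    rw [Measure.pi_pi]
    exact Finset.prod_le_prod' fun i _ => h i (s i)
  refine Measure.le_iff.2 fun s hs => ?_
  refine (hout s).trans (le_of_eq ?_)
  rw [Measure.pi, toMeasure_apply _ _ hs]

theorem pi_smul_measure {ι : Type*} [Fintype ι] (c : ι → NNReal) (ν : ι → Measure ℝ)
    [∀ i, SigmaFinite (ν i)] :
    Measure.pi (fun i => c i • ν i) = (∏ i, c i) • Measure.pi ν := by
  refine Measure.pi_eq fun s _ => ?_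
  simp only [Measure.smul_apply, Measure.pi_pi, ENNReal.smul_def, smul_eq_mul,
    Finset.prod_mul_distrib, ENNReal.ofNNReal_finsetProd]

/-- Stretching the coordinates in `D` by `κ`. -/
def stretch {ι : Type*} [DecidableEq ι] (D : Finset ι) (κ : ℝ) (α : ι → ℝ) (i : ι) : ℝ :=
  if i ∈ D then κ * α i else α i

theorem pi_stretch_preimage_le {ι : Type*} [Fintype ι] [DecidableEq ι] {ν : Measure ℝ}
    [IsProbabilityMeasure ν] {κ δ : ℝ} {t : NNReal}
    (h : (ν.map (κ * ·)).restrict (Set.Iic δ) ≤ t • ν) (D : Finset ι) {A : Set (ι → ℝ)}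
    (hA : MeasurableSet A) :
    Measure.pi (fun _ : ι => ν) (stretch D κ ⁻¹' (A ∩ {α | ∀ i ∈ D, α i ≤ δ})) ≤
      (t : ℝ≥0∞) ^ D.card * Measure.pi (fun _ : ι => ν) A := by
  set g : ι → ℝ → ℝ := fun i x => if i ∈ D then κ * x else x with hg
  have hgm : ∀ i, Measurable (g i) := fun i => by
    simp only [hg]; split_ifs <;> fun_prop
  have hmapp : ∀ i, IsProbabilityMeasure (ν.map (g i)) := fun i =>
    Measure.isProbabilityMeasure_map (hgm i).aemeasurable
  set B : ι → Set ℝ := fun i => if i ∈ D then Set.Iic δ else Set.univ with hB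
  have hBm : ∀ i, MeasurableSet (B i) := fun i => by
    simp only [hB]; split_ifs
    · exact measurableSet_Iic
    · exact MeasurableSet.univ
  have hbox : {α : ι → ℝ | ∀ i ∈ D, α i ≤ δ} = Set.pi Set.univ B := by
    ext α
    simp only [Set.mem_ofPred_eq, Set.mem_pi, Set.mem_univ, true_implies, hB]
    refine forall_congr' fun i => ?_
    by_cases hi : i ∈ D <;> simp [hi]
  have hstr : stretch D κ = fun (α : ι → ℝ) i => g i (α i) := rfl
  have hsm : Measurable (stretch (ι := ι) D κ) := by
    rw [hstr]
    exact measurable_pi_lambda _ fun i => (hgm i).comp (measurable_pi_apply i)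
  have hBpi : MeasurableSet (Set.pi Set.univ B) := MeasurableSet.univ_pi hBm
  rw [hbox, ← Measure.map_apply hsm (hA.inter hBpi), ← Measure.restrict_apply hA, hstr,
    Measure.pi_map_pi (fun i => (hgm i).aemeasurable), Measure.restrict_pi_pi]
  have hle : ∀ i, (ν.map (g i)).restrict (B i) ≤ (if i ∈ D then t else 1) • ν := by
    intro i
    by_cases hi : i ∈ D
    · simpa only [hg, hB, hi, if_true] using h
    · simp [hg, hB, hi]
  refine (pi_mono_measure hle A).trans (le_of_eq ?_)
  rw [pi_smul_measure, Measure.smul_apply, Finset.prod_ite_mem, Finset.univ_inter,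
    Finset.prod_const, ENNReal.smul_def, smul_eq_mul, ENNReal.coe_pow]

end Product

/-! ### Pairwise error events of minimal weight -/

section Quadratic

variable {k n : ℕ} (G : Matrix (Fin k) (Fin n) (ZMod 2)[X]) {H : ℕ} {γ σ N₀ : ℝ}

/-- The event that the noise outweighs the envelopes on `D`. -/
def noiseEvent (D : Finset (SymIdx G H)) (s : SymIdx G H → ℝ) (b : ℝ) :
    Set ((SymIdx G H → ℝ) × (SymIdx G H → ℝ)) :=
  {ω | 0 ≤ ∑ p ∈ D, (s p * ω.1 p * ω.2 p - b * ω.1 p ^ 2)}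

theorem measurableSet_noiseEvent (D : Finset (SymIdx G H)) (s : SymIdx G H → ℝ) (b : ℝ) :
    MeasurableSet (noiseEvent G D s b) :=
  measurableSet_le measurable_const (by fun_prop)

/-- For fixed noise, the form with coefficient `b` at `κ α` is `κ` times the form with coefficient
`κ b` at `α`. The harder event is therefore a preimage of the easier one under stretching; the
comparison of laws applies while the stretched envelopes stay below `δ`, and the rest is split off.
-/
theorem channelLaw_noiseEvent_scale_le (hγ : 0 ≤ γ) (hσ : 0 < σ) {κ t δ : ℝ} (hκ : 0 < κ)
    (ht : 0 ≤ t) (h : ∀ a ≤ δ, κ⁻¹ * ricianPDF (√(2 * γ) * σ) σ (κ⁻¹ * a) ≤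
      t * ricianPDF (√(2 * γ) * σ) σ a) (D : Finset (SymIdx G H)) (s : SymIdx G H → ℝ) (b : ℝ) :
    channelLaw G H γ σ N₀ (noiseEvent G D s (κ * b)) ≤
      ENNReal.ofReal (t ^ D.card) * channelLaw G H γ σ N₀ (noiseEvent G D s b) +
      ∑ p ∈ D, channelLaw G H γ σ N₀ (noiseEvent G D s (κ * b) ∩ {ω | δ < κ * ω.1 p}) := by
  classical
  have := isProbabilityMeasure_ricianLaw hγ hσ
  have hsub : noiseEvent G D s (κ * b) ⊆
      (noiseEvent G D s (κ * b) ∩ {ω | ∀ p ∈ D, κ * ω.1 p ≤ δ}) ∪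
        ⋃ p ∈ D, (noiseEvent G D s (κ * b) ∩ {ω | δ < κ * ω.1 p}) := by
    intro ω hω
    by_cases hall : ∀ p ∈ D, κ * ω.1 p ≤ δ
    · exact Or.inl ⟨hω, hall⟩
    · push Not at hall
      obtain ⟨p, hp, hlt⟩ := hall
      exact Or.inr (Set.mem_iUnion₂.2 ⟨p, hp, hω, hlt⟩)
  refine (measure_mono hsub).trans ((measure_union_le _ _).trans
    (add_le_add ?_ (measure_biUnion_finset_le _ _)))
  have hm1 : MeasurableSet (noiseEvent G D s (κ * b) ∩ {ω | ∀ p ∈ D, κ * ω.1 p ≤ δ}) := by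
    refine (measurableSet_noiseEvent G D s _).inter ?_
    have : {ω : (SymIdx G H → ℝ) × (SymIdx G H → ℝ) | ∀ p ∈ D, κ * ω.1 p ≤ δ} =
        ⋂ p ∈ D, {ω | κ * ω.1 p ≤ δ} := by
      ext ω
      simp
    rw [this]
    exact Finset.measurableSet_biInter D fun p _ => measurableSet_le (by fun_prop) measurable_const
  have hm2 := measurableSet_noiseEvent G D s b
  rw [channelLaw, Measure.prod_apply_symm hm1, Measure.prod_apply_symm hm2,
    ← lintegral_const_mul _ (measurable_measure_prodMk_right hm2)]
  refine lintegral_mono fun z => ?_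
  have hpre : (fun α : SymIdx G H → ℝ => (α, z)) ⁻¹'
      (noiseEvent G D s (κ * b) ∩ {ω | ∀ p ∈ D, κ * ω.1 p ≤ δ}) =
      stretch D κ ⁻¹' ((fun α : SymIdx G H → ℝ => (α, z)) ⁻¹' noiseEvent G D s b ∩
        {α | ∀ p ∈ D, α p ≤ δ}) := by
    ext α
    simp only [Set.mem_preimage, Set.mem_inter_iff, Set.mem_ofPred_eq, noiseEvent]
    refine and_congr ?_ (forall₂_congr fun p hp => by simp [stretch, hp])
    have : ∑ p ∈ D, (s p * stretch D κ α p * z p - b * stretch D κ α p ^ 2) =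
        κ * ∑ p ∈ D, (s p * α p * z p - κ * b * α p ^ 2) := by
      rw [Finset.mul_sum]
      refine Finset.sum_congr rfl fun p hp => ?_
      rw [stretch, if_pos hp]
      ring
    rw [this]
    exact (mul_nonneg_iff_of_pos_left hκ).symm
  rw [hpre, ENNReal.ofReal_pow ht]
  exact pi_stretch_preimage_le (map_mul_ricianLaw_restrict_le hκ ht h) D
    (measurable_prodMk_right hm2)

theorem gaussianReal_signed_tail (hN : 0 < N₀) {s : ℝ} (hs : s = 1 ∨ s = -1) :
    gaussianReal 0 (N₀ / 2).toNNReal {z | √(N₀ / 2) ≤ s * z} = gaussianReal 0 1 (Set.Ici 1) := by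
  have hτ : 0 < √(N₀ / 2) := Real.sqrt_pos.2 (by positivity)
  have hs2 : s ^ 2 = 1 := by rcases hs with rfl | rfl <;> norm_num
  have hmap := gaussianReal_map_const_mul (μ := 0) (v := 1) (s * √(N₀ / 2))
  have hvar : NNReal.mk ((s * √(N₀ / 2)) ^ 2) (sq_nonneg _) * 1 = (N₀ / 2).toNNReal := by
    rw [mul_one]
    apply NNReal.eq
    rw [Real.coe_toNNReal _ (by positivity)]
    show (s * √(N₀ / 2)) ^ 2 = N₀ / 2
    rw [mul_pow, hs2, one_mul, Real.sq_sqrt (by positivity)]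
  rw [mul_zero, hvar] at hmap
  rw [← hmap, Measure.map_apply (by fun_prop) (measurableSet_le measurable_const (by fun_prop))]
  congr 1
  ext x
  simp only [Set.mem_preimage, Set.mem_ofPred_eq, Set.mem_Ici]
  have : s * (s * √(N₀ / 2) * x) = √(N₀ / 2) * x := by linear_combination √(N₀ / 2) * x * hs2
  rw [this]
  exact le_mul_iff_one_le_right hτ

theorem gaussianReal_Ici_pos : 0 < gaussianReal 0 1 (Set.Ici 1) := by
  rw [pos_iff_ne_zero]
  intro h
  have := gaussianReal_absolutelyContinuous' 0 (v := 1) one_ne_zero h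
  simp at this

/-- The probability of the noise event is of order `q⁻²` to the power `|D|` at least. -/
theorem exists_le_channelLaw_noiseEvent (hγ : 0 ≤ γ) (hσ : 0 < σ) :
    ∃ c > 0, ∃ δ > 0, ∀ (N₀ q : ℝ) (D : Finset (SymIdx G H)) (s : SymIdx G H → ℝ), 0 < N₀ →
      0 < q → q⁻¹ ≤ δ → (∀ p, s p = 1 ∨ s p = -1) →
      ENNReal.ofReal ((c * (q ^ 2)⁻¹) ^ D.card) ≤
        channelLaw G H γ σ N₀ (noiseEvent G D s (q * √(N₀ / 2))) := by
  classical
  have := isProbabilityMeasure_ricianLaw hγ hσ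
  obtain ⟨c, hc, δ, hδ, h⟩ := exists_le_ricianLaw_Ioc γ hσ
  set g := (gaussianReal 0 1).real (Set.Ici 1) with hg
  have hgE : ENNReal.ofReal g = gaussianReal 0 1 (Set.Ici 1) := by simp [hg]
  have hgpos : 0 < g := by
    rw [← ENNReal.ofReal_pos, hgE]
    exact gaussianReal_Ici_pos
  refine ⟨c * g, by positivity, δ, hδ, fun N₀ q D s hN hq hqδ hs => ?_⟩
  have hτ : 0 < √(N₀ / 2) := Real.sqrt_pos.2 (by positivity)
  -- It suffices that each envelope on `D` is at most `1/q`, of probability of order `q⁻²`, and each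
  -- signed noise at least one standard deviation, of constant probability.
  have hsub : (Set.pi (D : Set (SymIdx G H)) fun _ => Set.Ioc (q⁻¹ / 2) q⁻¹) ×ˢ
      (Set.pi (D : Set (SymIdx G H)) fun p => {z | √(N₀ / 2) ≤ s p * z}) ⊆
      noiseEvent G D s (q * √(N₀ / 2)) := by
    rintro ⟨α, z⟩ ⟨hα, hz⟩
    show 0 ≤ ∑ p ∈ D, (s p * α p * z p - q * √(N₀ / 2) * α p ^ 2)
    refine Finset.sum_nonneg fun p hp => ?_
    have h1 := hα p hp
    have h2 : √(N₀ / 2) ≤ s p * z p := hz p hp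
    have h0 : 0 < α p := lt_trans (by positivity) h1.1
    have h3 : q * α p ≤ 1 := by
      have := mul_le_mul_of_nonneg_left h1.2 hq.le
      rwa [mul_inv_cancel₀ hq.ne'] at this
    have h4 : s p * α p * z p - q * √(N₀ / 2) * α p ^ 2 =
        α p * ((s p * z p - √(N₀ / 2)) + √(N₀ / 2) * (1 - q * α p)) := by ring
    show 0 ≤ s p * α p * z p - q * √(N₀ / 2) * α p ^ 2
    rw [h4]
    exact mul_nonneg h0.le (add_nonneg (by linarith) (mul_nonneg hτ.le (by linarith)))
  refine le_trans ?_ (measure_mono hsub)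
  rw [channelLaw, Measure.prod_prod, Measure.pi_pi_finset, Measure.pi_pi_finset]
  simp_rw [fun p => gaussianReal_signed_tail hN (hs p)]
  rw [Finset.prod_const, Finset.prod_const, ← mul_pow, ENNReal.ofReal_pow (by positivity)]
  gcongr
  rw [← hgE, show c * g * (q ^ 2)⁻¹ = c * q⁻¹ ^ 2 * g by rw [inv_pow]; ring,
    ENNReal.ofReal_mul (by positivity)]
  gcongr
  exact h _ (by positivity) hqδ

end Quadratic

/-! ### Comparison of the bit error probabilities with and without retransmissions -/

section Comparison

variable {k n : ℕ} (G : Matrix (Fin k) (Fin n) (ZMod 2)[X]) {H : ℕ} {γ σ Eb N₀ : ℝ}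

/-- The event that `v` passes the test against the sent message `w`. -/
def marginEvent (Eb N₀ u : ℝ) (w v : Msg k H) : Set ((SymIdx G H → ℝ) × (SymIdx G H → ℝ)) :=
  {ω | Margin G N₀ u ω.1 (received G Eb w ω.1 ω.2) (H + memory G) v w}

/-- The event that `v` and `v'` are both at least as likely as the sent message `w`. -/
def rivalsEvent (Eb : ℝ) (w v v' : Msg k H) : Set ((SymIdx G H → ℝ) × (SymIdx G H → ℝ)) :=
  {ω | metric G ω.1 (received G Eb w ω.1 ω.2) (H + memory G) w ≤
      metric G ω.1 (received G Eb w ω.1 ω.2) (H + memory G) v ∧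
    metric G ω.1 (received G Eb w ω.1 ω.2) (H + memory G) w ≤
      metric G ω.1 (received G Eb w ω.1 ω.2) (H + memory G) v'}

theorem measurableSet_rivalsEvent (w v v' : Msg k H) :
    MeasurableSet (rivalsEvent G Eb w v v') := by
  have hm : ∀ v : Msg k H, Measurable fun ω : (SymIdx G H → ℝ) × (SymIdx G H → ℝ) =>
      metric G ω.1 (received G Eb w ω.1 ω.2) (H + memory G) v := by
    intro v
    unfold metric received
    fun_prop
  exact (measurableSet_le (hm w) (hm v)).inter (measurableSet_le (hm w) (hm v'))

theorem rivalsEvent_self (N₀ : ℝ) (w v : Msg k H) :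
    rivalsEvent G Eb w v v = marginEvent G Eb N₀ 0 w v := by
  ext ω
  simp only [rivalsEvent, marginEvent, Set.mem_ofPred_eq, and_self]
  exact metric_le_iff_margin_zero G N₀ _ _ _ _

theorem marginEvent_eq_noiseEvent (hE : 0 ≤ Eb) (hN : 0 < N₀) (u : ℝ) (w v : Msg k H) :
    marginEvent G Eb N₀ u w v = noiseEvent G (diffSet G w v) (symbol G v)
      ((snr G H Eb N₀ + u / freeDist G) * √(N₀ / 2)) := by
  have hτ : 0 < √(N₀ / 2) := Real.sqrt_pos.2 (by positivity)
  ext ω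
  simp only [marginEvent, noiseEvent, Set.mem_ofPred_eq]
  rw [margin_received_iff G hE hN]
  have : ∑ p, ((symbol G v p - symbol G w p) / √(N₀ / 2) * ω.1 p * ω.2 p +
        (snr G H Eb N₀ * symbol G w p * (symbol G v p - symbol G w p) -
          u / freeDist G * |symbol G w p - symbol G v p|) * ω.1 p ^ 2) =
      2 / √(N₀ / 2) * ∑ p ∈ diffSet G w v, (symbol G v p * ω.1 p * ω.2 p -
        (snr G H Eb N₀ + u / freeDist G) * √(N₀ / 2) * ω.1 p ^ 2) := by
    rw [diffSet, Finset.sum_filter, Finset.mul_sum]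
    refine Finset.sum_congr rfl fun p _ => ?_
    rcases symbol_eq_or G w p with h1 | h1 <;> rcases symbol_eq_or G v p with h2 | h2 <;>
      rw [h1, h2] <;> norm_num [abs_of_pos, abs_of_neg] <;> field_simp <;> ring
  rw [this]
  exact mul_nonneg_iff_of_pos_left (by positivity)

/-- The Chernoff bound for the noise event has slack `Q²/2` at each position of `D`. Spending `Q²/4`
of it at `p₀`, where the stretched envelope exceeds `δ`, gives an exponentially small bound that
does not depend on `κ`. -/
theorem channelLaw_noiseEvent_inter_le (hγ : 0 ≤ γ) (hσ : 0 < σ) (hN : 0 < N₀)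
    {D : Finset (SymIdx G H)} {s : SymIdx G H → ℝ} (hs : ∀ p, s p = 1 ∨ s p = -1) {q δ κ : ℝ}
    (hq : 0 ≤ q) (hκ : 0 < κ) (hδ : 0 < δ) {p₀ : SymIdx G H} (hp₀ : p₀ ∈ D) :
    channelLaw G H γ σ N₀ (noiseEvent G D s (κ * (q * √(N₀ / 2))) ∩ {ω | δ < κ * ω.1 p₀}) ≤
      ENNReal.ofReal (Real.exp (-(q ^ 2 * δ ^ 2 / 4))) := by
  classical
  have hτ : 0 < √(N₀ / 2) := Real.sqrt_pos.2 (by positivity)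
  set Q := κ * q with hQ
  set A : SymIdx G H → ℝ := fun p => if p ∈ D then Q * s p else 0 with hA
  set B : SymIdx G H → ℝ := fun p => (if p ∈ D then Q ^ 2 else 0) -
    if p = p₀ then Q ^ 2 / 4 else 0 with hB
  have hAB : ∀ p, A p ^ 2 / 2 ≤ B p := by
    intro p
    have hs2 : s p ^ 2 = 1 := by rcases hs p with h | h <;> rw [h] <;> norm_num
    simp only [hA, hB]
    by_cases hpD : p ∈ D
    · rw [if_pos hpD, if_pos hpD, mul_pow, hs2]
      split_ifs <;> nlinarith [sq_nonneg Q]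
    · have : p ≠ p₀ := fun h => hpD (h ▸ hp₀)
      simp [hpD, this]
  have := channelLaw_le_of_normalized G hγ hσ hN (A := A) (B := B) (c := 0)
    (L := q ^ 2 * δ ^ 2 / 4) (S := ∅) le_rfl hAB (by simp)
    (E := noiseEvent G D s (κ * (q * √(N₀ / 2))) ∩ {ω | δ < κ * ω.1 p₀}) ?_
  · simpa using this
  · rintro ω ⟨h1, h2⟩
    simp only [noiseEvent, Set.mem_ofPred_eq] at h1 h2
    have h3 : ∑ p, (A p / √(N₀ / 2) * ω.1 p * ω.2 p - B p * ω.1 p ^ 2) =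
        Q / √(N₀ / 2) * ∑ p ∈ D, (s p * ω.1 p * ω.2 p - κ * (q * √(N₀ / 2)) * ω.1 p ^ 2) +
          Q ^ 2 / 4 * ω.1 p₀ ^ 2 := by
      have h4 : Q ^ 2 / 4 * ω.1 p₀ ^ 2 =
          ∑ p, (if p = p₀ then Q ^ 2 / 4 else 0) * ω.1 p ^ 2 := by
        simp [ite_mul]
      have h5 : ∀ f : SymIdx G H → ℝ, ∑ p ∈ D, f p = ∑ p, if p ∈ D then f p else 0 := by
        intro f
        rw [Finset.sum_ite_mem, Finset.univ_inter]
      rw [h4, h5, Finset.mul_sum, ← Finset.sum_add_distrib]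
      refine Finset.sum_congr rfl fun p _ => ?_
      simp only [hA, hB]
      by_cases hpD : p ∈ D
      · simp only [if_pos hpD, hQ]
        field_simp
        ring
      · simp only [if_neg hpD]
        ring
    rw [h3]
    have h6 : q ^ 2 * δ ^ 2 ≤ Q ^ 2 * ω.1 p₀ ^ 2 := by
      have : δ ^ 2 ≤ (κ * ω.1 p₀) ^ 2 := pow_le_pow_left₀ hδ.le h2.le 2
      calc q ^ 2 * δ ^ 2 ≤ q ^ 2 * (κ * ω.1 p₀) ^ 2 := by gcongr
        _ = Q ^ 2 * ω.1 p₀ ^ 2 := by rw [hQ]; ring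
    have h7 := mul_nonneg (by positivity : 0 ≤ Q / √(N₀ / 2)) h1
    linarith

theorem exp_neg_le_inv_pow (N : ℕ) {b x : ℝ} (hb : 0 < b) (hx : 0 < x) :
    Real.exp (-(x * b)) ≤ (N.factorial / b ^ N) * x⁻¹ ^ N := by
  have h := Real.pow_div_factorial_le_exp (x * b) (by positivity) N
  rw [Real.exp_neg]
  calc (Real.exp (x * b))⁻¹ ≤ ((x * b) ^ N / N.factorial)⁻¹ := inv_anti₀ (by positivity) h
    _ = (N.factorial / b ^ N) * x⁻¹ ^ N := by
      rw [inv_div, mul_pow, inv_pow]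
      field_simp

/-- Raising the flag to `θ d √(2 E_c / N₀)` divides the pairwise error probabilities at distance
`d` by about `(1 + θ) ^ (2 d)`. -/
theorem exists_channelLaw_marginEvent_le (hγ : 0 ≤ γ) (hσ : 0 < σ) (hG : 0 < freeDist G)
    {θ t : ℝ} (hθ : 0 ≤ θ) (ht : ((1 + θ) ^ 2)⁻¹ < t) (d : ℕ) :
    ∃ C, 0 ≤ C ∧ ∀ (Eb N₀ : ℝ) (w v : Msg k H), 0 ≤ Eb → 0 < N₀ → 0 < snr G H Eb N₀ →
      (diffSet G w v).card = d →
      channelLaw G H γ σ N₀ (marginEvent G Eb N₀ (θ * (freeDist G * snr G H Eb N₀)) w v) ≤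
        ENNReal.ofReal (t ^ d) * channelLaw G H γ σ N₀ (marginEvent G Eb N₀ 0 w v) +
          ENNReal.ofReal (C * (snr G H Eb N₀ ^ 2)⁻¹ ^ (d + 1)) := by
  have hκ : 0 < 1 + θ := by linarith
  have hd : (0 : ℝ) < freeDist G := by exact_mod_cast hG
  have ht0 : 0 ≤ t := le_trans (by positivity) ht.le
  obtain ⟨δ, hδ, h⟩ := exists_ricianPDF_scale_le γ hσ hκ ht
  refine ⟨d * ((d + 1).factorial / (δ ^ 2 / 4) ^ (d + 1)), by positivity, ?_⟩
  intro Eb N₀ w v hE hN hq hcard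
  set q := snr G H Eb N₀ with hqdef
  rw [marginEvent_eq_noiseEvent G hE hN, marginEvent_eq_noiseEvent G hE hN, ← hqdef, zero_div,
    add_zero, show (q + θ * (freeDist G * q) / freeDist G) * √(N₀ / 2) =
      (1 + θ) * (q * √(N₀ / 2)) by field_simp]
  refine (channelLaw_noiseEvent_scale_le G hγ hσ hκ ht0 h _ _ _).trans ?_
  rw [hcard]
  gcongr
  refine (Finset.sum_le_sum fun p hp => channelLaw_noiseEvent_inter_le G hγ hσ hN
    (symbol_eq_or G v) hq.le hκ hδ hp).trans ?_
  rw [Finset.sum_const, hcard, nsmul_eq_mul, ← ENNReal.ofReal_natCast,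
    ← ENNReal.ofReal_mul (by positivity), mul_assoc]
  gcongr
  rw [mul_div_assoc]
  exact exp_neg_le_inv_pow (d + 1) (by positivity) (by positivity)

theorem ricianLaplace_pow_le_inv (hγ : 0 ≤ γ) (hσ : 0 < σ) {c q : ℝ} (hc : 0 < c) (hq : 0 < q)
    (N : ℕ) : ricianLaplace γ σ (c * q ^ 2) ^ N ≤ (2 * σ ^ 2 * c)⁻¹ ^ N * (q ^ 2)⁻¹ ^ N := by
  have hpos : 0 < c * q ^ 2 := by positivity
  rw [← mul_pow, ← mul_inv]
  refine pow_le_pow_left₀ (ricianLaplace_pos γ hpos.le).le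
    ((ricianLaplace_le_inv hγ hσ hpos).trans (le_of_eq ?_)) _
  ring_nf

theorem channelLaw_rivalsEvent_le (hG : 0 < freeDist G) (hγ : 0 ≤ γ) (hσ : 0 < σ) (hE : 0 ≤ Eb)
    (hN : 0 < N₀) (hq : 0 < snr G H Eb N₀) {d : ℕ} {w v v' : Msg k H} (hne : v ≠ v')
    (hv : d ≤ (diffSet G w v).card) (hv' : d ≤ (diffSet G w v').card) :
    channelLaw G H γ σ N₀ (rivalsEvent G Eb w v v') ≤
      ENNReal.ofReal ((2 * σ ^ 2 * (3 / 8))⁻¹ ^ (d + 1) * (snr G H Eb N₀ ^ 2)⁻¹ ^ (d + 1)) :=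
  (channelLaw_two_rivals_le G hγ hσ hE hN w v v').trans (ENNReal.ofReal_le_ofReal
    ((ricianLaplace_pow_le hγ (by positivity) (card_union_diffSet hG hne hv hv')).trans
      (ricianLaplace_pow_le_inv hγ hσ (by norm_num) hq _)))

theorem channelLaw_marginEvent_le (hG : 0 < freeDist G) (hγ : 0 ≤ γ) (hσ : 0 < σ) (hE : 0 ≤ Eb)
    (hN : 0 < N₀) (hq : 0 < snr G H Eb N₀) {θ : ℝ} (hθ : 0 ≤ θ) {N : ℕ} {w v : Msg k H}
    (hv : N ≤ (diffSet G w v).card) :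
    channelLaw G H γ σ N₀ (marginEvent G Eb N₀ (θ * (freeDist G * snr G H Eb N₀)) w v) ≤
      ENNReal.ofReal ((2 * σ ^ 2 * ((1 + θ) ^ 2 / 2))⁻¹ ^ N * (snr G H Eb N₀ ^ 2)⁻¹ ^ N) := by
  have hd : (0 : ℝ) < freeDist G := by exact_mod_cast hG
  have h1 := channelLaw_margin_le G hγ hσ hE hN (θ * (freeDist G * snr G H Eb N₀))
    (by positivity) w v w
  simp only [le_refl, and_true] at h1
  refine h1.trans (ENNReal.ofReal_le_ofReal ?_)
  rw [diffSet_comm v w]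
  refine (ricianLaplace_pow_le hγ (by positivity) hv).trans ?_
  rw [show (snr G H Eb N₀ + θ * (freeDist G * snr G H Eb N₀) / freeDist G) ^ 2 / 2 =
    (1 + θ) ^ 2 / 2 * snr G H Eb N₀ ^ 2 by field_simp]
  exact ricianLaplace_pow_le_inv hγ hσ (by positivity) hq _

/-- The messages at distance `d` from `w` with a wrong bit `(h, a)`. -/
def wrongNeighbors (d : ℕ) (w : Msg k H) (h : Fin H) (a : Fin k) : Finset (Msg k H) :=
  Finset.univ.filter fun v => v h a ≠ w h a ∧ (diffSet G w v).card = d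

/-- An accepted wrong `v` has a rival `r` from `Accepts.exists_margin`. If `r = w`, then `v` beats
`w` at distance `d` (main term) or more (remainder); otherwise `v` and `r` are two distinct rivals
of `w` (remainder). -/
theorem exists_bitErrorEvent_le_sum (hG : 0 < freeDist G) (hγ : 0 ≤ γ) (hσ : 0 < σ) {θ : ℝ}
    (hθ : 0 ≤ θ) {d : ℕ} (hd : ∀ w v : Msg k H, w ≠ v → d ≤ (diffSet G w v).card) :
    ∃ C, 0 ≤ C ∧ ∀ (Eb N₀ : ℝ) (w : Msg k H) (h : Fin H) (a : Fin k), 0 ≤ Eb → 0 < N₀ →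
      0 < snr G H Eb N₀ →
      channelLaw G H γ σ N₀
          (bitErrorEvent G Eb N₀ (θ * (freeDist G * snr G H Eb N₀)) w h a) ≤
        ∑ v ∈ wrongNeighbors G d w h a, channelLaw G H γ σ N₀
          (marginEvent G Eb N₀ (θ * (freeDist G * snr G H Eb N₀)) w v) +
        ENNReal.ofReal (C * (snr G H Eb N₀ ^ 2)⁻¹ ^ (d + 1)) := by
  classical
  set K := (Fintype.card (Msg k H) : ℝ) with hK
  set C₁ := (2 * σ ^ 2 * ((1 + θ) ^ 2 / 2))⁻¹ ^ (d + 1) with hC₁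
  set C₂ := (2 * σ ^ 2 * (3 / 8))⁻¹ ^ (d + 1) with hC₂
  have hC₁0 : 0 ≤ C₁ := by positivity
  have hC₂0 : 0 ≤ C₂ := by positivity
  refine ⟨K * C₁ + K * (K * C₂), by positivity, fun Eb N₀ w h a hE hN hq => ?_⟩
  set x := (snr G H Eb N₀ ^ 2)⁻¹ ^ (d + 1) with hx
  have hx0 : 0 ≤ x := by positivity
  set u := θ * (freeDist G * snr G H Eb N₀) with hu
  have hu0 : 0 ≤ u := by positivity
  set s₁ : Finset (Msg k H) := Finset.univ.filter fun v => d + 1 ≤ (diffSet G w v).card with hs₁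
  set s₂ : Finset (Msg k H × Msg k H) :=
    Finset.univ.filter fun v => v.1 ≠ v.2 ∧ w ≠ v.1 ∧ w ≠ v.2 with hs₂
  have hsub : bitErrorEvent G Eb N₀ u w h a ⊆
      (⋃ v ∈ wrongNeighbors G d w h a, marginEvent G Eb N₀ u w v) ∪
        ((⋃ v ∈ s₁, marginEvent G Eb N₀ u w v) ∪ ⋃ v ∈ s₂, rivalsEvent G Eb w v.1 v.2) := by
    rintro ω ⟨v, hv, hne⟩
    have hvw : v ≠ w := fun heq => hne (by rw [heq])
    obtain ⟨r, h1, h2, h3⟩ := hv.exists_margin hvw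
    by_cases hrw : r = w
    · subst hrw
      rcases (hd r v hvw.symm).eq_or_lt with hcard | hcard
      · refine Or.inl (Set.mem_iUnion₂.2 ⟨v, ?_, h2⟩)
        simp only [wrongNeighbors, Finset.mem_filter_univ]
        exact ⟨hne, hcard.symm⟩
      · refine Or.inr (Or.inl (Set.mem_iUnion₂.2 ⟨v, ?_, h2⟩))
        simp only [hs₁, Finset.mem_filter_univ]
        exact hcard
    · refine Or.inr (Or.inr (Set.mem_iUnion₂.2 ⟨(v, r), ?_, ?_⟩))
      · simp only [hs₂, Finset.mem_filter_univ]
        exact ⟨h1.symm, hvw.symm, fun heq => hrw heq.symm⟩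
      · exact ⟨h3.trans (margin_le_metric hu0 h2), h3⟩
  refine (measure_mono hsub).trans ((measure_union_le _ _).trans (add_le_add
    (measure_biUnion_finset_le _ _) ((measure_union_le _ _).trans ?_)))
  rw [add_mul, ENNReal.ofReal_add (by positivity) (by positivity)]
  refine add_le_add ((measure_biUnion_finset_le _ _).trans ?_)
    ((measure_biUnion_finset_le _ _).trans ?_)
  · calc ∑ v ∈ s₁, channelLaw G H γ σ N₀ (marginEvent G Eb N₀ u w v)
        ≤ ∑ v ∈ s₁, ENNReal.ofReal (C₁ * x) := by
          refine Finset.sum_le_sum fun v hv => ?_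
          simp only [hs₁, Finset.mem_filter_univ] at hv
          exact channelLaw_marginEvent_le G hG hγ hσ hE hN hq hθ hv
      _ ≤ ∑ v : Msg k H, ENNReal.ofReal (C₁ * x) :=
          Finset.sum_le_sum_of_subset (Finset.subset_univ _)
      _ = ENNReal.ofReal (K * C₁ * x) := by
          rw [Finset.sum_const, Finset.card_univ, nsmul_eq_mul, mul_assoc,
            ENNReal.ofReal_mul (p := K) (by positivity), hK, ENNReal.ofReal_natCast]
  · calc ∑ v ∈ s₂, channelLaw G H γ σ N₀ (rivalsEvent G Eb w v.1 v.2)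
        ≤ ∑ v ∈ s₂, ENNReal.ofReal (C₂ * x) := by
          refine Finset.sum_le_sum fun v hv => ?_
          simp only [hs₂, Finset.mem_filter_univ] at hv
          exact channelLaw_rivalsEvent_le G hG hγ hσ hE hN hq hv.1 (hd _ _ hv.2.1) (hd _ _ hv.2.2)
      _ ≤ ∑ v : Msg k H × Msg k H, ENNReal.ofReal (C₂ * x) :=
          Finset.sum_le_sum_of_subset (Finset.subset_univ _)
      _ = ENNReal.ofReal (K * (K * C₂) * x) := by
          rw [Finset.sum_const, Finset.card_univ, Fintype.card_prod, nsmul_eq_mul,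
            show K * (K * C₂) * x = (K * K) * (C₂ * x) by ring,
            ENNReal.ofReal_mul (p := K * K) (by positivity), hK, ← Nat.cast_mul,
            ENNReal.ofReal_natCast]

/-- Outside the event `bad` that `w` has two rivals, the pairwise events are disjoint, and in each
of them the single rival beats every other word, so it is decoded with its wrong bit. -/
theorem exists_sum_le_bitErrorEvent (hG : 0 < freeDist G) (hγ : 0 ≤ γ) (hσ : 0 < σ)
    {d : ℕ} (hd : ∀ w v : Msg k H, w ≠ v → d ≤ (diffSet G w v).card) :
    ∃ C, 0 ≤ C ∧ ∀ (Eb N₀ : ℝ) (w : Msg k H) (h : Fin H) (a : Fin k), 0 ≤ Eb → 0 < N₀ →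
      0 < snr G H Eb N₀ →
      ∑ v ∈ wrongNeighbors G d w h a, channelLaw G H γ σ N₀ (marginEvent G Eb N₀ 0 w v) ≤
        channelLaw G H γ σ N₀ (bitErrorEvent G Eb N₀ 0 w h a) +
        ENNReal.ofReal (C * (snr G H Eb N₀ ^ 2)⁻¹ ^ (d + 1)) := by
  classical
  set K := (Fintype.card (Msg k H) : ℝ) with hK
  set C₂ := (2 * σ ^ 2 * (3 / 8))⁻¹ ^ (d + 1) with hC₂
  have hC₂0 : 0 ≤ C₂ := by positivity
  refine ⟨K * (K * K * C₂), by positivity, fun Eb N₀ w h a hE hN hq => ?_⟩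
  set x := (snr G H Eb N₀ ^ 2)⁻¹ ^ (d + 1) with hx
  have hx0 : 0 ≤ x := by positivity
  set s₂ : Finset (Msg k H × Msg k H) :=
    Finset.univ.filter fun v => v.1 ≠ v.2 ∧ w ≠ v.1 ∧ w ≠ v.2 with hs₂
  set bad := ⋃ v ∈ s₂, rivalsEvent G Eb w v.1 v.2 with hbad
  have hbadm : MeasurableSet bad :=
    Finset.measurableSet_biUnion _ fun v _ => measurableSet_rivalsEvent G w v.1 v.2
  have hbadle : channelLaw G H γ σ N₀ bad ≤ ENNReal.ofReal (K * K * C₂ * x) := by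
    refine (measure_biUnion_finset_le _ _).trans ?_
    calc ∑ v ∈ s₂, channelLaw G H γ σ N₀ (rivalsEvent G Eb w v.1 v.2)
        ≤ ∑ v ∈ s₂, ENNReal.ofReal (C₂ * x) := by
          refine Finset.sum_le_sum fun v hv => ?_
          simp only [hs₂, Finset.mem_filter_univ] at hv
          exact channelLaw_rivalsEvent_le G hG hγ hσ hE hN hq hv.1 (hd _ _ hv.2.1) (hd _ _ hv.2.2)
      _ ≤ ∑ v : Msg k H × Msg k H, ENNReal.ofReal (C₂ * x) :=
          Finset.sum_le_sum_of_subset (Finset.subset_univ _)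
      _ = ENNReal.ofReal (K * K * C₂ * x) := by
          rw [Finset.sum_const, Finset.card_univ, Fintype.card_prod, nsmul_eq_mul, mul_assoc (K * K),
            ENNReal.ofReal_mul (p := K * K) (by positivity), hK, ← Nat.cast_mul,
            ENNReal.ofReal_natCast]
  have hne : ∀ v ∈ wrongNeighbors G d w h a, w ≠ v := by
    intro v hv heq
    simp only [wrongNeighbors, Finset.mem_filter_univ] at hv
    exact hv.1 (by rw [heq])
  have hmem : ∀ {ω v v'}, v ≠ v' → w ≠ v → w ≠ v' → ω ∈ rivalsEvent G Eb w v v' → ω ∈ bad := by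
    intro ω v v' h1 h2 h3 h4
    refine Set.mem_iUnion₂.2 ⟨(v, v'), ?_, h4⟩
    simp only [hs₂, Finset.mem_filter_univ]
    exact ⟨h1, h2, h3⟩
  have hmm : ∀ v : Msg k H, MeasurableSet (marginEvent G Eb N₀ 0 w v) := fun v => by
    rw [← rivalsEvent_self]
    exact measurableSet_rivalsEvent G w v v
  have hdisj : Set.PairwiseDisjoint (wrongNeighbors G d w h a : Set (Msg k H))
      fun v => marginEvent G Eb N₀ 0 w v \ bad := by
    intro v hv v' hv' hvv'
    refine Set.disjoint_left.2 fun ω h1 h2 => h1.2 ?_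
    have h3 := h1.1
    have h4 := h2.1
    rw [← rivalsEvent_self] at h3 h4
    exact hmem hvv' (hne v hv) (hne v' hv') ⟨h3.1, h4.1⟩
  have hsub : (⋃ v ∈ wrongNeighbors G d w h a, marginEvent G Eb N₀ 0 w v \ bad) ⊆
      bitErrorEvent G Eb N₀ 0 w h a := by
    intro ω hω
    obtain ⟨v, hv, h1, h2⟩ := Set.mem_iUnion₂.1 hω
    rw [← rivalsEvent_self] at h1
    refine ⟨v, accepts_of_forall_margin le_rfl fun r => ?_, ?_⟩
    · rw [← metric_le_iff_margin_zero]
      by_contra hlt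
      rw [not_le] at hlt
      refine h2 (hmem (v := v) (v' := r) ?_ (hne v hv) ?_ ⟨h1.1, h1.1.trans hlt.le⟩)
      · rintro rfl
        exact lt_irrefl _ hlt
      · rintro rfl
        exact absurd h1.1 (not_le.2 hlt)
    · simp only [wrongNeighbors, Finset.mem_filter_univ] at hv
      exact hv.1
  calc ∑ v ∈ wrongNeighbors G d w h a, channelLaw G H γ σ N₀ (marginEvent G Eb N₀ 0 w v)
      ≤ ∑ v ∈ wrongNeighbors G d w h a, (channelLaw G H γ σ N₀ (marginEvent G Eb N₀ 0 w v \ bad) +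
          channelLaw G H γ σ N₀ bad) := by
        refine Finset.sum_le_sum fun v _ => ?_
        refine (measure_mono (t := (marginEvent G Eb N₀ 0 w v \ bad) ∪ bad) ?_).trans
          (measure_union_le _ _)
        rw [Set.sdiff_union_self]
        exact Set.subset_union_left
    _ = channelLaw G H γ σ N₀ (⋃ v ∈ wrongNeighbors G d w h a, marginEvent G Eb N₀ 0 w v \ bad) +
          (wrongNeighbors G d w h a).card * channelLaw G H γ σ N₀ bad := by
        rw [Finset.sum_add_distrib, Finset.sum_const, nsmul_eq_mul,
          measure_biUnion_finset hdisj fun v _ => (hmm v).diff hbadm]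
    _ ≤ channelLaw G H γ σ N₀ (bitErrorEvent G Eb N₀ 0 w h a) +
          Fintype.card (Msg k H) * ENNReal.ofReal (K * K * C₂ * x) := by
        gcongr
        exact Finset.card_le_univ _
    _ = channelLaw G H γ σ N₀ (bitErrorEvent G Eb N₀ 0 w h a) +
          ENNReal.ofReal (K * (K * K * C₂) * x) := by
        rw [show K * (K * K * C₂) * x = K * (K * K * C₂ * x) by ring,
          ENNReal.ofReal_mul (p := K) (by positivity), hK, ENNReal.ofReal_natCast]

end Comparison

/-! ### Choice of the flag and absorption of the remainders -/

section Flag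

variable {k n : ℕ} (G : Matrix (Fin k) (Fin n) (ZMod 2)[X]) {H : ℕ} {γ σ : ℝ}

/-- A message of `H` blocks need not realize the free distance, so the asymptotics are governed by
this `d`, which may exceed `d_f`. -/
theorem exists_minimal_distance (hG : 0 < freeDist G) (hH : 0 < H) :
    ∃ (d : ℕ) (w v : Msg k H), freeDist G ≤ d ∧ w ≠ v ∧ (diffSet G w v).card = d ∧
      ∀ w v : Msg k H, w ≠ v → d ≤ (diffSet G w v).card := by
  classical
  have hk := (pos_of_freeDist_pos hG).1
  have hne : (Finset.univ.filter fun x : Msg k H × Msg k H => x.1 ≠ x.2).Nonempty := by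
    refine ⟨(0, 1), ?_⟩
    rw [Finset.mem_filter_univ]
    intro h
    exact zero_ne_one (congrFun (congrFun h ⟨0, hH⟩) ⟨0, hk⟩)
  obtain ⟨⟨w, v⟩, hwv, hmin⟩ := Finset.exists_min_image _
    (fun x : Msg k H × Msg k H => (diffSet G x.1 x.2).card) hne
  rw [Finset.mem_filter_univ] at hwv
  exact ⟨_, w, v, freeDist_le_card_diffSet hwv, hwv, rfl, fun w' v' h =>
    hmin (w', v') (by rwa [Finset.mem_filter_univ])⟩

/-- Cancelling `l` in the second hypothesis gives `l ≤ B`, so the additive error `g l` is absorbed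
as `g B`. -/
theorem le_ofReal_add_mul {A B : ℝ≥0∞} {r g l : ℝ} (hr : 0 ≤ r) (hg : 0 ≤ g) (hl : 0 ≤ l)
    (h1 : A ≤ ENNReal.ofReal r * B + ENNReal.ofReal (g * l))
    (h2 : ENNReal.ofReal (2 * l) ≤ B + ENNReal.ofReal l) : A ≤ ENNReal.ofReal (r + g) * B := by
  rw [two_mul, ENNReal.ofReal_add hl hl] at h2
  have h3 : ENNReal.ofReal l ≤ B := ENNReal.le_of_add_le_add_right ENNReal.ofReal_ne_top h2
  rw [ENNReal.ofReal_add hr hg, add_mul]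
  refine h1.trans ?_
  rw [ENNReal.ofReal_mul hg]
  gcongr

/-- At `θ = 1` the per-position factor is exactly `1/4`. By continuity one may take `t` slightly
above `1/4`, then `θ` slightly below `1`, as the retransmission bound requires. -/
theorem exists_flag_factor {ε : ℝ} (hε : 0 < ε) (d : ℕ) : ∃ θ t : ℝ, 0 < θ ∧ θ < 1 ∧ 0 < t ∧
    t < 1 ∧ ((1 + θ) ^ 2)⁻¹ < t ∧ t ^ d < (1 + ε) * (4 ^ d)⁻¹ := by
  have h1 : ∀ᶠ t : ℝ in 𝓝 (1 / 4), t ^ d < (1 + ε) * (4 ^ d)⁻¹ := by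
    refine ((continuous_pow d).tendsto (1 / 4 : ℝ)).eventually (gt_mem_nhds ?_)
    rw [one_div, inv_pow]
    have : (0 : ℝ) < (4 ^ d)⁻¹ := by positivity
    nlinarith
  have h2 : ∀ᶠ t : ℝ in 𝓝 (1 / 4), t < 1 := gt_mem_nhds (by norm_num)
  obtain ⟨t, ⟨⟨h3, h4⟩, h5⟩⟩ := (((h1.and h2).filter_mono
    (nhdsWithin_le_nhds (s := Set.Ioi (1 / 4)))).and self_mem_nhdsWithin).exists
  have h5 : 1 / 4 < t := h5
  have h6 : ∀ᶠ θ : ℝ in 𝓝 1, ((1 + θ) ^ 2)⁻¹ < t := by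
    have hc : ContinuousAt (fun θ : ℝ => ((1 + θ) ^ 2)⁻¹) 1 :=
      ContinuousAt.inv₀ (by fun_prop) (by norm_num)
    exact hc.eventually (gt_mem_nhds (by norm_num; linarith))
  have h7 : ∀ᶠ θ : ℝ in 𝓝 1, 0 < θ := lt_mem_nhds (by norm_num)
  obtain ⟨θ, ⟨⟨h8, h9⟩, h10⟩⟩ := (((h6.and h7).filter_mono
    (nhdsWithin_le_nhds (s := Set.Iio 1))).and self_mem_nhdsWithin).exists
  exact ⟨θ, t, h9, h10, by linarith, h4, h8, h3⟩

theorem exists_bitErrorProb_le_mul (hG : 0 < freeDist G) (hH : 0 < H) (hγ : 0 ≤ γ) (hσ : 0 < σ)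
    {ε : ℝ} (hε : 0 < ε) :
    ∃ θ, 0 < θ ∧ θ < 1 ∧ ∃ ρ₀, 0 < ρ₀ ∧ ∀ Eb N₀ : ℝ, 0 < Eb → 0 < N₀ → ρ₀ ≤ Eb / N₀ →
      bitErrorProb G H γ σ Eb N₀ (θ * (freeDist G * snr G H Eb N₀)) ≤
        ENNReal.ofReal ((1 + ε) * (4 ^ freeDist G)⁻¹) * bitErrorProb G H γ σ Eb N₀ 0 := by
  classical
  obtain ⟨θ, t, hθ0, hθ1, ht0, ht1, hθt, htε⟩ := exists_flag_factor hε (freeDist G)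
  obtain ⟨d, w₀, v₀, hdf, hne, hcard, hmin⟩ := exists_minimal_distance G (H := H) hG hH
  obtain ⟨C₁, hC₁, hup⟩ := exists_bitErrorEvent_le_sum G hG hγ hσ hθ0.le hmin
  obtain ⟨C₂, hC₂, hpair⟩ := exists_channelLaw_marginEvent_le G (H := H) hγ hσ hG hθ0.le hθt d
  obtain ⟨C₃, hC₃, hlow⟩ := exists_sum_le_bitErrorEvent G hG hγ hσ hmin
  obtain ⟨c, hc, δ, hδ, hpos⟩ := exists_le_channelLaw_noiseEvent G (H := H) hγ hσ
  obtain ⟨h₀, hh₀⟩ := Function.ne_iff.1 hne.symm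
  obtain ⟨a₀, ha₀⟩ := Function.ne_iff.1 hh₀
  have he := energyFactor_pos G hG hH
  set K := (Fintype.card (Msg k H) : ℝ) with hK
  set C₄ := C₁ + (K * C₂ + t ^ d * C₃) with hC₄
  have hC₄0 : 0 ≤ C₄ := by positivity
  set C₅ := K * (H * (k * C₄)) with hC₅
  have hC₅0 : 0 ≤ C₅ := by positivity
  -- The room left by `t` for absorbing remainders; `C₅` collects these over all messages and bits.
  set g := (1 + ε) * (4 ^ freeDist G)⁻¹ - t ^ freeDist G with hg
  have hg0 : 0 < g := sub_pos.2 htε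
  -- With `x = q⁻²`, the three bounds ensure `q⁻¹ ≤ δ`, then `C₃ x^{d+1} ≤ c^d x^d / 2`, and `C₅
  -- x^{d+1} ≤ g c^d x^d / 2`. The quantity `c^d x^d / 2` plays the role of `l` in
  -- `le_ofReal_add_mul`.
  set x₀ := min (δ ^ 2) (min (c ^ d / (2 * (C₃ + 1))) (g * c ^ d / (2 * (C₅ + 1)))) with hx₀
  have hx₀pos : 0 < x₀ := by positivity
  refine ⟨θ, hθ0, hθ1, (energyFactor G H * x₀)⁻¹, by positivity, fun Eb N₀ hE hN hρ => ?_⟩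
  have hsq := snr_sq G (H := H) hE.le hN
  have hq : 0 < snr G H Eb N₀ := by
    rw [snr_eq]
    positivity
  set q := snr G H Eb N₀ with hqdef
  set x := (q ^ 2)⁻¹ with hx
  have hxpos : 0 < x := by positivity
  have hxle : x ≤ x₀ := by
    rw [hx, hsq]
    rw [mul_inv, ← div_eq_inv_mul, div_le_iff₀ he] at hρ
    rw [inv_le_comm₀ (by positivity) hx₀pos]
    linarith
  have hx1 : x ≤ δ ^ 2 := hxle.trans (min_le_left _ _)
  have hx2 : x * (2 * (C₃ + 1)) ≤ c ^ d :=
    (le_div_iff₀ (by positivity)).1 (hxle.trans ((min_le_right _ _).trans (min_le_left _ _)))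
  have hx3 : x * (2 * (C₅ + 1)) ≤ g * c ^ d :=
    (le_div_iff₀ (by positivity)).1 (hxle.trans ((min_le_right _ _).trans (min_le_right _ _)))
  have hqδ : q⁻¹ ≤ δ := by
    rw [hx, ← inv_pow] at hx1
    exact (pow_le_pow_iff_left₀ (by positivity) hδ.le two_ne_zero).1 hx1
  set u := θ * (freeDist G * q) with hu
  have hone : ∀ (w : Msg k H) (h : Fin H) (a : Fin k),
      channelLaw G H γ σ N₀ (bitErrorEvent G Eb N₀ u w h a) ≤
        ENNReal.ofReal (t ^ d) * channelLaw G H γ σ N₀ (bitErrorEvent G Eb N₀ 0 w h a) +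
          ENNReal.ofReal (C₄ * x ^ (d + 1)) := by
    intro w h a
    refine (hup Eb N₀ w h a hE.le hN hq).trans ?_
    have h1 : ∑ v ∈ wrongNeighbors G d w h a, channelLaw G H γ σ N₀ (marginEvent G Eb N₀ u w v) ≤
        ENNReal.ofReal (t ^ d) * (channelLaw G H γ σ N₀ (bitErrorEvent G Eb N₀ 0 w h a) +
          ENNReal.ofReal (C₃ * x ^ (d + 1))) + ENNReal.ofReal (K * (C₂ * x ^ (d + 1))) := by
      calc ∑ v ∈ wrongNeighbors G d w h a, channelLaw G H γ σ N₀ (marginEvent G Eb N₀ u w v)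
          ≤ ∑ v ∈ wrongNeighbors G d w h a,
              (ENNReal.ofReal (t ^ d) * channelLaw G H γ σ N₀ (marginEvent G Eb N₀ 0 w v) +
                ENNReal.ofReal (C₂ * x ^ (d + 1))) := by
            refine Finset.sum_le_sum fun v hv => hpair Eb N₀ w v hE.le hN hq ?_
            simp only [wrongNeighbors, Finset.mem_filter_univ] at hv
            exact hv.2
        _ = ENNReal.ofReal (t ^ d) *
              ∑ v ∈ wrongNeighbors G d w h a, channelLaw G H γ σ N₀ (marginEvent G Eb N₀ 0 w v) +
              (wrongNeighbors G d w h a).card * ENNReal.ofReal (C₂ * x ^ (d + 1)) := by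
            rw [Finset.sum_add_distrib, Finset.sum_const, nsmul_eq_mul, Finset.mul_sum]
        _ ≤ _ := by
            rw [ENNReal.ofReal_mul (p := K) (by positivity), hK, ENNReal.ofReal_natCast]
            gcongr
            · exact hlow Eb N₀ w h a hE.le hN hq
            · exact Finset.card_le_univ _
    refine (add_le_add_left h1 _).trans (le_of_eq ?_)
    rw [mul_add, ← ENNReal.ofReal_mul (by positivity), add_assoc, add_assoc,
      ← ENNReal.ofReal_add (by positivity) (by positivity),
      ← ENNReal.ofReal_add (by positivity) (by positivity)]
    congr 2
    rw [hC₄]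
    ring
  have htot : ∑ w : Msg k H, ∑ h : Fin H, ∑ a : Fin k,
      channelLaw G H γ σ N₀ (bitErrorEvent G Eb N₀ u w h a) ≤
      ENNReal.ofReal (t ^ freeDist G) * ∑ w : Msg k H, ∑ h : Fin H, ∑ a : Fin k,
        channelLaw G H γ σ N₀ (bitErrorEvent G Eb N₀ 0 w h a) +
      ENNReal.ofReal (g * (c ^ d * x ^ d / 2)) := by
    refine (Finset.sum_le_sum fun w _ => Finset.sum_le_sum fun h _ => Finset.sum_le_sum fun a _ =>
      hone w h a).trans ?_
    simp only [Finset.sum_add_distrib, ← Finset.mul_sum, Finset.sum_const, Finset.card_univ,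
      nsmul_eq_mul, Fintype.card_fin]
    -- Since `t < 1` and `d_f ≤ d`, the gain `t^d` is at least as good as `t^{d_f}`.
    refine add_le_add (mul_le_mul_left (ENNReal.ofReal_le_ofReal
      (pow_le_pow_of_le_one ht0.le ht1.le hdf)) _) ?_
    rw [← ENNReal.ofReal_natCast, ← ENNReal.ofReal_natCast, ← ENNReal.ofReal_natCast,
      ← ENNReal.ofReal_mul (by positivity), ← ENNReal.ofReal_mul (by positivity),
      ← ENNReal.ofReal_mul (by positivity)]
    refine ENNReal.ofReal_le_ofReal ?_
    have h1 : 2 * (C₅ * x) ≤ g * c ^ d := by linarith only [hx3, hxpos]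
    have h2 := mul_le_mul_of_nonneg_right h1 (by positivity : 0 ≤ x ^ d)
    calc k * (H * (K * (C₄ * x ^ (d + 1)))) = 2 * (C₅ * x) * x ^ d / 2 := by rw [hC₅]; ring
      _ ≤ g * c ^ d * x ^ d / 2 := by linarith only [h2]
      _ = g * (c ^ d * x ^ d / 2) := by ring
  have hlower : ENNReal.ofReal (2 * (c ^ d * x ^ d / 2)) ≤
      ∑ w : Msg k H, ∑ h : Fin H, ∑ a : Fin k,
        channelLaw G H γ σ N₀ (bitErrorEvent G Eb N₀ 0 w h a) +
      ENNReal.ofReal (c ^ d * x ^ d / 2) := by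
    have h1 := hpos N₀ q (diffSet G w₀ v₀) (symbol G v₀) hN hq hqδ (symbol_eq_or G v₀)
    have h2 := marginEvent_eq_noiseEvent G hE.le hN 0 w₀ v₀
    rw [zero_div, add_zero, ← hqdef] at h2
    rw [hcard, ← h2, mul_pow] at h1
    have h3 : channelLaw G H γ σ N₀ (marginEvent G Eb N₀ 0 w₀ v₀) ≤
        ∑ v ∈ wrongNeighbors G d w₀ h₀ a₀, channelLaw G H γ σ N₀ (marginEvent G Eb N₀ 0 w₀ v) := by
      refine Finset.single_le_sum
        (f := fun v => channelLaw G H γ σ N₀ (marginEvent G Eb N₀ 0 w₀ v)) (fun _ _ => zero_le) ?_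
      simp only [wrongNeighbors, Finset.mem_filter_univ]
      exact ⟨ha₀, hcard⟩
    have h4 : channelLaw G H γ σ N₀ (bitErrorEvent G Eb N₀ 0 w₀ h₀ a₀) ≤
        ∑ w : Msg k H, ∑ h : Fin H, ∑ a : Fin k,
          channelLaw G H γ σ N₀ (bitErrorEvent G Eb N₀ 0 w h a) :=
      (Finset.single_le_sum (f := fun a => channelLaw G H γ σ N₀
        (bitErrorEvent G Eb N₀ 0 w₀ h₀ a)) (fun _ _ => zero_le) (Finset.mem_univ a₀)).trans
      ((Finset.single_le_sum (f := fun h => ∑ a : Fin k, channelLaw G H γ σ N₀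
        (bitErrorEvent G Eb N₀ 0 w₀ h a)) (fun _ _ => zero_le) (Finset.mem_univ h₀)).trans
      (Finset.single_le_sum (f := fun w => ∑ h : Fin H, ∑ a : Fin k, channelLaw G H γ σ N₀
        (bitErrorEvent G Eb N₀ 0 w h a)) (fun _ _ => zero_le) (Finset.mem_univ w₀)))
    rw [mul_div_cancel₀ _ two_ne_zero]
    refine h1.trans (h3.trans ((hlow Eb N₀ w₀ h₀ a₀ hE.le hN hq).trans
      (add_le_add h4 (ENNReal.ofReal_le_ofReal ?_))))
    have h5 : 2 * (C₃ * x) ≤ c ^ d := by linarith only [hx2, hxpos]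
    have h6 := mul_le_mul_of_nonneg_right h5 (by positivity : 0 ≤ x ^ d)
    rw [pow_succ]
    linarith only [h6]
  have hfin := le_ofReal_add_mul (by positivity) hg0.le (by positivity) htot hlower
  rw [hg, add_sub_cancel] at hfin
  unfold bitErrorProb
  rw [← mul_div_assoc]
  exact ENNReal.div_le_div_right hfin _

end Flag

end RicianViterbi

end

theorem theorem1 {k n : ℕ} (G : Matrix (Fin k) (Fin n) (ZMod 2)[X])
    (hG : 0 < RicianViterbi.freeDist G) (H : ℕ) (hH : 0 < H) (σ : ℝ) (hσ : 0 < σ) :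
    -- without ARQ
    (∀ γ : ℝ, 0 ≤ γ → ∃ C ρ₀ : ℝ, 0 < ρ₀ ∧ ∀ Eb N₀ : ℝ, 0 < Eb → 0 < N₀ → ρ₀ ≤ Eb / N₀ →
      RicianViterbi.bitErrorProb G H γ σ Eb N₀ 0 ≤
        ENNReal.ofReal (C * ((Eb / N₀) ^ RicianViterbi.freeDist G)⁻¹)) ∧
    -- with ARQ
    (∀ γ : ℝ, 0 ≤ γ → ∀ ε : ℝ, 0 < ε → ∃ u₀ : ℝ → ℝ, (∀ ρ : ℝ, 0 < ρ → 0 < u₀ ρ) ∧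
      ∃ C ρ₀ : ℝ, 0 < ρ₀ ∧ ∀ Eb N₀ : ℝ, 0 < Eb → 0 < N₀ → ρ₀ ≤ Eb / N₀ →
        RicianViterbi.retransProb G H γ σ Eb N₀ (u₀ (Eb / N₀)) ≤
          ENNReal.ofReal (C * ((Eb / N₀) ^ RicianViterbi.freeDist G)⁻¹) ∧
        RicianViterbi.bitErrorProb G H γ σ Eb N₀ (u₀ (Eb / N₀)) ≤
          ENNReal.ofReal ((1 + ε) * (4 ^ RicianViterbi.freeDist G)⁻¹) *
            RicianViterbi.bitErrorProb G H γ σ Eb N₀ 0) ∧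
    -- exponents with respect to the Rician factor
    (∀ Eb N₀ u : ℝ, 0 < Eb → 0 < N₀ → 0 ≤ u →
      (((RicianViterbi.freeDist G : ℝ) * RicianViterbi.hTilde G H σ Eb N₀ u : ℝ) : EReal) ≤
          liminf (fun γ : ℝ =>
            -ENNReal.log (RicianViterbi.bitErrorProb G H γ σ Eb N₀ u) / (γ : EReal)) atTop ∧
      (u < RicianViterbi.freeDist G * √(2 * RicianViterbi.codeEnergy G H Eb / N₀) →
        (((RicianViterbi.freeDist G : ℝ) * RicianViterbi.hTilde G H σ Eb N₀ (-u) : ℝ) : EReal) ≤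
          liminf (fun γ : ℝ =>
            -ENNReal.log (RicianViterbi.retransProb G H γ σ Eb N₀ u) / (γ : EReal)) atTop)) := by
  open RicianViterbi in
  refine ⟨fun γ hγ => ?_, fun γ hγ ε hε => ?_, fun Eb N₀ u hE hN hu => ⟨?_, fun hu' => ?_⟩⟩
  · exact ⟨_, 1, one_pos, fun Eb N₀ hE hN _ => bitErrorProb_zero_le G hG hH hγ hσ hE hN⟩
  · obtain ⟨θ, hθ0, hθ1, ρ₀, hρ₀, h⟩ := exists_bitErrorProb_le_mul G hG hH hγ hσ hε
    have he := energyFactor_pos G hG hH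
    have hd : (0 : ℝ) < freeDist G := by exact_mod_cast hG
    obtain ⟨C, hC⟩ : ∃ C : ℝ, ∀ Eb N₀ : ℝ, 0 < Eb → 0 < N₀ →
        retransProb G H γ σ Eb N₀ (θ * (freeDist G * snr G H Eb N₀)) ≤
          ENNReal.ofReal (C * ((Eb / N₀) ^ freeDist G)⁻¹) :=
      ⟨_, fun Eb N₀ hE hN => retransProb_le_ratio G hG hH hγ hσ hE hN hθ0.le hθ1⟩
    -- The square root is `q` written through `ρ = E_b/N₀`, so the flag depends on this ratio alone.
    refine ⟨fun ρ => θ * (freeDist G * √(energyFactor G H * ρ)), fun ρ hρ => by positivity,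
      C, ρ₀, hρ₀, fun Eb N₀ hE hN hρ => ?_⟩
    simp only [← snr_eq]
    exact ⟨hC Eb N₀ hE hN, h Eb N₀ hE hN hρ⟩
  · exact le_liminf_bitErrorProb G hσ hE.le hN hu
  · exact le_liminf_retransProb G hG hσ hE.le hN hu hu'
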